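/- Let $T \ge 1$, let $\mathbf Y=(Y_1,\dots,Y_T)$ be a stochastic process with values in $\mathbb R^D$, write $Y_{[t]}=(Y_1,\dots,Y_t)$ and $\mathcal F_t=\sigma(Y_{[t]})$, and let $Z_t=g_t(Y_{[t]})$ for (measurable) payoff functions $g_t$. Set $Z^1_t=Z_t$, $Z^{k+1}_t=Z^k_t-E\big[\min_{1\le i\le T}Z^k_i\,\big|\,\mathcal F_t\big]$ and $H_k=E\big[\min_{1\le t\le T}Z^k_t\big]$ for $k\ge1$. A base simulator $\mathcal B$ takes as input $t\in\{0,\dots,T\}$ and a history $\gamma\in\mathbb R^{D\times t}$ and returns a sample of $\mathbf Y$ conditioned on $Y_{[t]}=\gamma$ (regular conditional distribution; unconditioned if $t=0$), independent of all its previous samples. Each call to $\mathcal B$ costs $C\ge1$ units of time, each evaluation of some $g_t$ costs $G\ge1$ units, and each addition, subtraction, multiplication, division, maximum or minimum of two numbers costs one unit; reading, writing and storing numbers is free. (Each logarithm, each rounding up to an integer and each pass through a loop is also charged one unit.) For $k\ge1$ and $\epsilon,\delta\in(0,1)$ let $$f_k(\epsilon,\delta)=10^{2(k-1)^2}\,\epsilon^{-2(k-1)}\,(T+2)^{k-1}\Big(1+\log\tfrac1\delta+\log\tfrac1\epsilon+\log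 T\Big)^{k-1}.$$ Theorem. For every $k\ge1$ there is a randomized algorithm $\hat{\mathcal B}^k$, which takes as input $\epsilon,\delta\in(0,1)$ (and the horizon $T$) and has access to $\mathbf Y$ only through calls to the base simulator $\mathcal B$ and to the payoffs only through evaluations of the $g_t$, such that the following holds whenever $Z_t\in[0,1]$ almost surely for all $t\in\{1,\dots,T\}$. For all $\epsilon,\delta\in(0,1)$, in total computational time at most $(C+G+1)\,f_{k+1}(\epsilon,\delta)$, with at most $f_{k+1}(\epsilon,\delta)$ calls to $\mathcal B$ and no other access to randomness, the algorithm returns a random number $X$ with $P\big(|X-H_k|\le\epsilon\big)\ge1-\delta$. The algorithm depends only on $k$, not on $T$, $D$, $\mathbf Y$, $(g_t)$, $\mathcal B$, $C$, $G$. -/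

import Mathlib

open MeasureTheory ProbabilityTheory

namespace NestedSim

/-! ## The stopping problem -/

/-- Partial histories with `t` columns: `D × t` real matrices, stored column by column.
A full sample path is a history with `T` columns. -/
abbrev Hist (D t : ℕ) : Type := Fin t → Fin D → ℝ

/-- The first `t` columns of a full path. -/
def firstCols {D T t : ℕ} (h : t ≤ T) (y : Hist D T) : Hist D t :=
  fun i => y (Fin.castLE h i)

section StoppingProblem

variable {Ω : Type*} [MeasurableSpace Ω] {T D : ℕ}

/-- The `σ`-field generated by the first `i + 1` columns of `Y`
(the time `i : Fin T` stands for time `i + 1` in `{1, …, T}`). -/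
abbrev pastSigma (Y : Ω → Hist D T) (i : Fin T) : MeasurableSpace Ω :=
  MeasurableSpace.comap (fun ω => firstCols (Nat.succ_le_of_lt i.isLt) (Y ω)) inferInstance

/-- The payoff process: at time `i + 1` it is `g (i + 1)` applied to the first `i + 1` columns. -/
def payoffProc (Y : Ω → Hist D T) (g : (t : ℕ) → Hist D t → ℝ) (i : Fin T) (ω : Ω) : ℝ :=
  g (i + 1) (firstCols (Nat.succ_le_of_lt i.isLt) (Y ω))

/-- The processes `Z^k`, `k ≥ 1`: `Z^1` is the payoff process and
`Z^{k+1}_t = Z^k_t - E[min_i Z^k_i | F_t]`. Level `0` is not used. -/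
noncomputable def levelProc (P : Measure Ω) (Y : Ω → Hist D T) (g : (t : ℕ) → Hist D t → ℝ) :
    ℕ → Fin T → Ω → ℝ
  | 0 => fun _ _ => 0
  | 1 => payoffProc Y g
  | k + 2 => fun t ω => levelProc P Y g (k + 1) t ω
      - (P[fun ω' => ⨅ i : Fin T, levelProc P Y g (k + 1) i ω' | pastSigma Y t]) ω

/-- `H_k = E[min_t Z^k_t]`. -/
noncomputable def levelValue (P : Measure Ω) (Y : Ω → Hist D T) (g : (t : ℕ) → Hist D t → ℝ)
    (k : ℕ) : ℝ :=
  ∫ ω, (⨅ i : Fin T, levelProc P Y g k i ω) ∂P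

/-- A base simulator: a randomized procedure which on input `t ∈ {0, …, T}` and a history `γ`
with `t` columns draws a seed with law `ν` and returns `sim t γ seed`, distributed as `Y`
conditioned on `Y_[t] = γ` (in the sense of regular conditional distributions; for `t = 0` this
is the unconditioned law of `Y`). -/
structure IsSimulator {S : Type*} [MeasurableSpace S] (P : Measure Ω) [IsFiniteMeasure P]
    (Y : Ω → Hist D T) (ν : Measure S) (sim : (t : ℕ) → Hist D t → S → Hist D T) : Prop where
  measurable_sim : ∀ t ≤ T, Measurable fun x : Hist D t × S => sim t x.1 x.2
  law_sim : ∀ t, ∀ ht : t ≤ T, ∀ᵐ γ ∂(P.map fun ω => firstCols ht (Y ω)),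
    ν.map (sim t γ) = condDistrib Y (fun ω => firstCols ht (Y ω)) P γ

end StoppingProblem

/-! ## The computational model

Programs are finite pieces of code over real registers, index (natural number) registers and path
registers. They see the stopping problem only through calls to the base simulator and evaluations
of the payoff functions. -/

/-- Binary arithmetic operations. -/
inductive Op
  | add | sub | mul | div | max | min

/-- The value of a binary operation. -/
noncomputable def Op.eval : Op → ℝ → ℝ → ℝ
  | .add, x, y => x + y
  | .sub, x, y => x - y
  | .mul, x, y => x * y
  | .div, x, y => x / y
  | .max, x, y => Max.max x y
  | .min, x, y => Min.min x y

/-- Code. Each argument named `r, a, b` is the number of a real register, `i, n` of an index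
register, and `p, q` of a path register. -/
inductive Code
  /-- do nothing -/
  | skip
  /-- run two pieces of code one after the other -/
  | seq (c₁ c₂ : Code)
  /-- write a literal into real register `r` -/
  | const (r : ℕ) (value : ℕ)
  /-- copy real register `a` into real register `r` -/
  | copy (r a : ℕ)
  /-- write a literal into index register `i` -/
  | setIdx (i : ℕ) (value : ℕ)
  /-- copy index register `i` into real register `r` -/
  | cast (r i : ℕ)
  /-- real register `r` receives `a` op `b` -/
  | arith (o : Op) (r a b : ℕ)
  /-- real register `r` receives the natural logarithm of `a` -/
  | log (r a : ℕ)
  /-- index register `i` receives the ceiling of `a` -/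
  | ceil (i a : ℕ)
  /-- path register `p` receives the answer of the base simulator to the query consisting of
  `t`, the content of index register `i`, and the first `t` columns of path register `q` -/
  | sample (p i q : ℕ)
  /-- real register `r` receives the payoff `g t` of the first `t` columns of path register `q`,
  where `t` is the content of index register `i` -/
  | payoff (r i q : ℕ)
  /-- for `i = 1, …, N` do `body`, with `N` the content of index register `n` on entry -/
  | loop (i n : ℕ) (body : Code)

/-- Memory content, with three counters: calls to the simulator, payoff evaluations, and
elementary operations. -/
structure Memory (D T : ℕ) where
  real : ℕ → ℝ
  idx : ℕ → ℕ
  path : ℕ → Hist D T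
  calls : ℕ
  evals : ℕ
  ops : ℕ

section Execution

variable {S : Type*} {T D : ℕ}

/-- Execution of a piece of code, given the payoff functions, the simulator and the sequence of
seeds; the `m`-th simulator call of a run uses the `m`-th seed. Every arithmetic operation,
logarithm and ceiling, as well as every pass through a loop, counts as one elementary operation.
Moving numbers between registers is free. Queries with a time outside the admissible range leave
the registers unchanged (and are counted). -/
noncomputable def exec (g : (t : ℕ) → Hist D t → ℝ) (sim : (t : ℕ) → Hist D t → S → Hist D T)
    (seed : ℕ → S) : Code → Memory D T → Memory D T
  | .skip, σ => σ
  | .seq c₁ c₂, σ => exec g sim seed c₂ (exec g sim seed c₁ σ)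
  | .const r v, σ => { σ with real := Function.update σ.real r (v : ℝ) }
  | .copy r a, σ => { σ with real := Function.update σ.real r (σ.real a) }
  | .setIdx i v, σ => { σ with idx := Function.update σ.idx i v }
  | .cast r i, σ => { σ with real := Function.update σ.real r (σ.idx i : ℝ) }
  | .arith o r a b, σ =>
      { σ with
        real := Function.update σ.real r (o.eval (σ.real a) (σ.real b))
        ops := σ.ops + 1 }
  | .log r a, σ =>
      { σ with
        real := Function.update σ.real r (Real.log (σ.real a))
        ops := σ.ops + 1 }
  | .ceil i a, σ =>
      { σ with
        idx := Function.update σ.idx i ⌈σ.real a⌉₊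
        ops := σ.ops + 1 }
  | .sample p i q, σ =>
      { σ with
        path := if h : σ.idx i ≤ T then
            Function.update σ.path p
              (sim (σ.idx i) (firstCols h (σ.path q)) (seed σ.calls))
          else σ.path
        calls := σ.calls + 1 }
  | .payoff r i q, σ =>
      { σ with
        real := if h : 1 ≤ σ.idx i ∧ σ.idx i ≤ T then
            Function.update σ.real r (g (σ.idx i) (firstCols h.2 (σ.path q)))
          else σ.real
        evals := σ.evals + 1 }
  | .loop i n c, σ =>
      (List.range (σ.idx n)).foldl
        (fun τ m => exec g sim seed c
          { τ with idx := Function.update τ.idx i (m + 1), ops := τ.ops + 1 }) σ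

/-- Memory at the start: `ε` and `δ` in the real registers `0` and `1`, the horizon `T` in index
register `0`, and zero everywhere else. -/
noncomputable def initMemory (D T : ℕ) (ε δ : ℝ) : Memory D T where
  real := fun r => if r = 0 then ε else if r = 1 then δ else 0
  idx := fun i => if i = 0 then T else 0
  path := fun _ => 0
  calls := 0
  evals := 0
  ops := 0

/-- Memory at the end of the run of a program on input `ε, δ`. -/
noncomputable def run (g : (t : ℕ) → Hist D t → ℝ) (sim : (t : ℕ) → Hist D t → S → Hist D T)
    (c : Code) (ε δ : ℝ) (seed : ℕ → S) : Memory D T :=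
  exec g sim seed c (initMemory D T ε δ)

/-- The number which a terminated run returns: the content of real register `0`. -/
def Memory.output (σ : Memory D T) : ℝ := σ.real 0

/-- Total computational time: `C` per simulator call, `G` per payoff evaluation, and `1` per
elementary operation. -/
noncomputable def Memory.time (C G : ℝ) (σ : Memory D T) : ℝ :=
  C * σ.calls + G * σ.evals + σ.ops

end Execution

/-- `f_k(ε, δ)`, for `k ≥ 1` and horizon `T`. -/
noncomputable def costBound (T k : ℕ) (ε δ : ℝ) : ℝ :=
  10 ^ (2 * (k - 1) ^ 2) * (1 / ε) ^ (2 * (k - 1)) * ((T : ℝ) + 2) ^ (k - 1)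
    * (1 + Real.log (1 / δ) + Real.log (1 / ε) + Real.log T) ^ (k - 1)

end NestedSim

/-! The algorithm is plain nested Monte Carlo with one number `M` of repetitions used at every
level. To estimate `Z^(j+2)` at time `t` on a path, take the estimate of `Z^(j+1)` there and
subtract an average, over `M` fresh continuations sampled from the first `t` columns, of the minimum
over time of the level `j` estimates along the continuation. The final answer is such an average at
`t = 0`. Once `M` is fixed, all counts are deterministic, and each level multiplies the cost by at
most `M * (T + 2)`.

Why it is accurate: each `Z^(j+1)` stays in `[0, 1]`, because `min_i Z_i ≤ Z_t` and `Z_t` is known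
at time `t` (`levelProc_mem_Icc`). So Hoeffding's inequality applies to each average of true minima:
it is within `η` of its mean except with probability `p = 2 exp(-2 M η²)`. Taking minima does not
amplify errors, so if the level `j` error is `a`, the average has error at most `a + η` and level `j
+ 1` has error `2 a + η`; hence `a = (2 ^ j - 1) η`, the final error is `2 ^ j η`, and `η = ε / 2 ^
j`. A union bound over all inner estimates (`avgMin_accuracy`, `est_accuracy`) multiplies the
failure probability by at most `M * (T + 2)` per level. This growth is polynomial in `M`, whereas
`p` is exponentially small in `M η²`, so `M` of order `ε⁻² log(T / (δ ε))` suffices (`fail_le`), and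
the same `M` fits the cost bound (`twice_pow_le_costBound`).

Two points need care. Accuracy can hold only for almost every history; this survives nesting because
a continuation sampled from a random history again has the law of `Y` (`IsSimulator.ae_ae_simAt`).
And the processes are defined by conditional expectations, which must be identified with integrals
over simulator seeds (`levelProc_ae_eq_target`). The rest shows that the code really computes this
estimator, consuming consecutive seeds. -/

namespace NestedSim

/-! ## The estimator -/

/-- The minimum of `1` and the first `n` terms of a sequence. -/
noncomputable def runMin (f : ℕ → ℝ) : ℕ → ℝ
  | 0 => 1
  | n + 1 => min (runMin f n) (f n)

section Estimator

variable {S : Type*} {T D : ℕ}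

/-- The sequence without its first `a` terms. -/
def shift (a : ℕ) (s : ℕ → S) : ℕ → S := fun n => s (a + n)

theorem shift_shift (a b : ℕ) (s : ℕ → S) : shift a (shift b s) = shift (b + a) s := by
  funext n
  simp [shift, Nat.add_assoc]

/-- The payoff at time `t` as a function of the full path. -/
noncomputable def payoffAt (g : (t : ℕ) → Hist D t → ℝ) (t : ℕ) (y : Hist D T) : ℝ :=
  if h : t ≤ T then g t (firstCols h y) else 0

/-- The simulator as a function of the full path. -/
noncomputable def simAt (sim : (t : ℕ) → Hist D t → S → Hist D T) (t : ℕ) (y : Hist D T) (ξ : S) :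
    Hist D T :=
  if h : t ≤ T then sim t (firstCols h y) ξ else y

/-- The number of seeds used by the level `j` estimator with `M` repetitions per average. -/
def callCount (T M : ℕ) : ℕ → ℕ
  | 0 => 0
  | j + 1 => callCount T M j + M * (1 + T * callCount T M j)

/-- The number of payoff evaluations of the level `j` estimator. -/
def evalCount (T M : ℕ) : ℕ → ℕ
  | 0 => 1
  | j + 1 => evalCount T M j + M * (T * evalCount T M j)

/-- The number of elementary operations of the level `j` estimator. -/
def opCount (T M : ℕ) : ℕ → ℕ
  | 0 => 0
  | j + 1 => opCount T M j + (M * (2 + T * (opCount T M j + 2)) + 2)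

/-- The average over `M` sampled continuations of a path of the minimum over time of an
estimator `e` which uses `c` seeds. -/
noncomputable def avgMin (sim : (t : ℕ) → Hist D t → S → Hist D T) (M c : ℕ)
    (e : ℕ → Hist D T → (ℕ → S) → ℝ) (t : ℕ) (y : Hist D T) (s : ℕ → S) : ℝ :=
  (∑ m ∈ Finset.range M, runMin (fun i => e (i + 1) (simAt sim t y (s (m * (1 + T * c))))
    (shift (m * (1 + T * c) + 1 + i * c) s)) T) / M

/-- The level `j` estimator: the estimate of the process `Z^(j+1)`. -/
noncomputable def est (g : (t : ℕ) → Hist D t → ℝ) (sim : (t : ℕ) → Hist D t → S → Hist D T)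
    (M : ℕ) : ℕ → ℕ → Hist D T → (ℕ → S) → ℝ
  | 0 => fun t y _ => payoffAt g t y
  | j + 1 => fun t y s => est g sim M j t y s
      - avgMin sim M (callCount T M j) (est g sim M j) t y (shift (callCount T M j) s)

end Estimator

/-! ## The program -/

/-- Code for the average of the level `j` minima, on the basis of code `body` for the
level `j` estimator; the result is left in real register `3 * j + 3`. -/
def avgCode (j : ℕ) (body : Code) (i q : ℕ) : Code :=
  .seq (.const (3 * j + 3) 0) <|
  .seq (.loop (2 * j + 2) 1 <|
    .seq (.sample j i q) <|
    .seq (.const (3 * j + 4) 1) <|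
    .seq (.loop (2 * j + 3) 0 <| .seq body (.arith .min (3 * j + 4) (3 * j + 4) (3 * j + 5))) <|
    .arith .add (3 * j + 3) (3 * j + 3) (3 * j + 4)) <|
  .arith .div (3 * j + 3) (3 * j + 3) 2

/-- Code for the level `j` estimator, with the time in index register `i`, the path in path
register `q`, and the result in real register `r`. -/
def estCode : ℕ → ℕ → ℕ → ℕ → Code
  | 0 => fun r i q => .payoff r i q
  | j + 1 => fun r i q =>
      .seq (estCode j r i q) <|
      .seq (avgCode j (estCode j (3 * j + 5) (2 * j + 3) j) i q) <|
      .arith .sub r r (3 * j + 3)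

/-! ### Correctness of the code: register use, seed positions and counters -/

section Semantics

variable {S : Type*} {T D : ℕ}

/-- A computation step which uses only the registers of the levels below `j` (and real
register `r`), with given numbers of calls, evaluations and operations. -/
structure Step (j r c e o : ℕ) (σ τ : Memory D T) : Prop where
  real : ∀ r', r' ≠ r → (r' < 3 ∨ 3 * j + 3 ≤ r') → τ.real r' = σ.real r'
  idx : ∀ i, (i < 2 ∨ 2 * j + 2 ≤ i) → τ.idx i = σ.idx i
  path : ∀ q, j ≤ q → τ.path q = σ.path q
  calls : τ.calls = σ.calls + c
  evals : τ.evals = σ.evals + e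
  ops : τ.ops = σ.ops + o

/-- The registers with the horizon and the number of repetitions are set. -/
structure Ready (M : ℕ) (σ : Memory D T) : Prop where
  horizon : σ.idx 0 = T
  reps : σ.idx 1 = M
  reps_real : σ.real 2 = M

/-- The loop invariant rule for `Code.loop`. -/
theorem foldl_range_induction {α : Type*} (p : ℕ → α → Prop) (f : α → ℕ → α) (a : α) (n : ℕ)
    (h0 : p 0 a) (hs : ∀ m < n, ∀ b, p m b → p (m + 1) (f b m)) :
    p n ((List.range n).foldl f a) := by
  induction n with
  | zero => simpa
  | succ n ih =>
    rw [List.range_succ, List.foldl_append]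
    exact hs n n.lt_succ_self _ (ih fun m hm => hs m (hm.trans n.lt_succ_self))

/-- The code `body` computes the estimator `f` at level `j`. -/
def Computes (g : (t : ℕ) → Hist D t → ℝ) (sim : (t : ℕ) → Hist D t → S → Hist D T)
    (seed : ℕ → S) (M j c e o r i q : ℕ) (f : ℕ → Hist D T → (ℕ → S) → ℝ) (body : Code) : Prop :=
  ∀ σ : Memory D T, Ready M σ → 1 ≤ σ.idx i → σ.idx i ≤ T →
    (exec g sim seed body σ).real r = f (σ.idx i) (σ.path q) (shift σ.calls seed) ∧
    Step j r c e o σ (exec g sim seed body σ)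

variable {g : (t : ℕ) → Hist D t → ℝ} {sim : (t : ℕ) → Hist D t → S → Hist D T}
  {seed : ℕ → S} {M j c e o : ℕ} {f : ℕ → Hist D T → (ℕ → S) → ℝ} {body : Code}

theorem exec_sample_path {p i q : ℕ} (σ : Memory D T) (h : σ.idx i ≤ T) :
    (exec g sim seed (.sample p i q) σ).path =
      Function.update σ.path p (simAt sim (σ.idx i) (σ.path q) (seed σ.calls)) := by
  simp [exec, simAt, h]

/-- The scratch registers of level `j` are: real `3 * j + 3` (running sum), `3 * j + 4` (running
minimum), `3 * j + 5` (inner estimate), index `2 * j + 2` (repetition), `2 * j + 3` (time), path `j`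
(continuation). The code `body` writes only its result register and scratch of lower levels, so the
loop state survives it. The `3` in `Step (j + 1) 3` exempts nothing new, as real register `3` is
already scratch there. -/
theorem exec_minLoop
    (hbody : Computes g sim seed M j c e o (3 * j + 5) (2 * j + 3) j f body)
    (σ : Memory D T) (hσ : Ready M σ) (h1 : σ.real (3 * j + 4) = 1) :
    let τ := exec g sim seed
      (.loop (2 * j + 3) 0 <| .seq body (.arith .min (3 * j + 4) (3 * j + 4) (3 * j + 5))) σ
    τ.real (3 * j + 4) =
        runMin (fun i => f (i + 1) (σ.path j) (shift (σ.calls + i * c) seed)) T ∧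
      τ.real (3 * j + 3) = σ.real (3 * j + 3) ∧ τ.idx (2 * j + 2) = σ.idx (2 * j + 2) ∧
      Step (j + 1) 3 (T * c) (T * e) (T * (o + 2)) σ τ := by
  intro τ
  -- `Step (j + 1)` is silent about the scratch of level `j`, so the sum, the repetition counter and
  -- the continuation are carried separately.
  let p : ℕ → Memory D T → Prop := fun n τ => 
    τ.real (3 * j + 4) =
        runMin (fun i => f (i + 1) (σ.path j) (shift (σ.calls + i * c) seed)) n ∧
      τ.real (3 * j + 3) = σ.real (3 * j + 3) ∧ τ.idx (2 * j + 2) = σ.idx (2 * j + 2) ∧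
      τ.path j = σ.path j ∧ Step (j + 1) 3 (n * c) (n * e) (n * (o + 2)) σ τ
  suffices h : p T τ from ⟨h.1, h.2.1, h.2.2.1, h.2.2.2.2⟩
  have := foldl_range_induction p (fun τ m => exec g sim seed
    (.seq body (.arith .min (3 * j + 4) (3 * j + 4) (3 * j + 5)))
          { τ with idx := Function.update τ.idx (2 * j + 3) (m + 1), ops := τ.ops + 1 }) σ T
    ⟨by simpa [runMin] using h1, rfl, rfl, rfl, by constructor <;> simp⟩ ?_
  · simpa [τ, exec, hσ.horizon] using this
  rintro m hm τ ⟨hmin, hacc, hidx, hpath, hstep⟩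
  have hready : Ready M { τ with
      idx := Function.update τ.idx (2 * j + 3) (m + 1), ops := τ.ops + 1 } := by
    refine ⟨?_, ?_, ?_⟩
    · simpa [Function.update_apply, hσ.horizon] using hstep.idx 0 (by omega)
    · simpa [Function.update_apply, hσ.reps] using hstep.idx 1 (by omega)
    · simpa [hσ.reps_real] using hstep.real 2 (by omega) (by omega)
  obtain ⟨hv, hs⟩ := hbody _ hready (by simp) (by simpa using hm)
  simp only [exec]
  set ρ := exec g sim seed body { τ with
      idx := Function.update τ.idx (2 * j + 3) (m + 1), ops := τ.ops + 1 } with hρ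
  refine ⟨?_, ?_, ?_, ?_, ?_⟩
  · have := hs.real (3 * j + 4) (by omega) (by omega)
    simp [Op.eval, runMin, this, hmin, hv, hpath, hstep.calls]
  · have := hs.real (3 * j + 3) (by omega) (by omega)
    simp [this, hacc]
  · have := hs.idx (2 * j + 2) (by omega)
    simp [this, hidx]
  · have := hs.path j le_rfl
    simp [this, hpath]
  · constructor
    · intro r hr hr'
      have h2 := hs.real r (by omega) (by omega)
      have h3 := hstep.real r hr hr'
      have : r ≠ 3 * j + 4 := by omega
      simp [this, h2, h3]
    · intro i hi
      have h2 := hs.idx i (by omega)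
      have h3 := hstep.idx i hi
      have : i ≠ 2 * j + 3 := by omega
      simp [h2, h3, this]
    · intro q hq
      have h2 := hs.path q (by omega)
      simp [h2, hstep.path q hq]
    · simp [hs.calls, hstep.calls]; ring
    · simp [hs.evals, hstep.evals]; ring
    · simp [hs.ops, hstep.ops]; ring

/-- Each repetition consumes a block of `1 + T * c` seeds: one for the continuation, then `c` for
each time. The bounds on `i` and `q` put the query above all scratch registers in use, so that it
stays intact through the `M` repetitions. -/
theorem exec_avgCode {i q : ℕ} (hi : 2 * j + 4 ≤ i) (hq : j + 1 ≤ q)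
    (hbody : Computes g sim seed M j c e o (3 * j + 5) (2 * j + 3) j f body)
    (σ : Memory D T) (hσ : Ready M σ) (ht : σ.idx i ≤ T) :
    (exec g sim seed (avgCode j body i q) σ).real (3 * j + 3) =
        avgMin sim M c f (σ.idx i) (σ.path q) (shift σ.calls seed) ∧
      Step (j + 1) 3 (M * (1 + T * c)) (M * (T * e)) (M * (2 + T * (o + 2)) + 1) σ
        (exec g sim seed (avgCode j body i q) σ) := by
  let inner : Code := .seq (.sample j i q) <|
    .seq (.const (3 * j + 4) 1) <|
    .seq (.loop (2 * j + 3) 0 <| .seq body (.arith .min (3 * j + 4) (3 * j + 4) (3 * j + 5))) <|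
    .arith .add (3 * j + 3) (3 * j + 3) (3 * j + 4)
  let F : ℕ → ℝ := fun m => runMin (fun i' => f (i' + 1)
    (simAt sim (σ.idx i) (σ.path q) (shift σ.calls seed (m * (1 + T * c))))
    (shift (m * (1 + T * c) + 1 + i' * c) (shift σ.calls seed))) T
  let p : ℕ → Memory D T → Prop := fun n τ => 
    τ.real (3 * j + 3) = ∑ m ∈ Finset.range n, F m ∧
      Step (j + 1) 3 (n * (1 + T * c)) (n * (T * e)) (n * (2 + T * (o + 2))) σ τ
  let σ' : Memory D T := { σ with real := Function.update σ.real (3 * j + 3) 0 }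
  have key := foldl_range_induction p (fun τ m => exec g sim seed inner
          { τ with idx := Function.update τ.idx (2 * j + 2) (m + 1), ops := τ.ops + 1 }) σ' M
    ⟨by simp [σ'], by
      constructor <;> simp only [σ', Nat.zero_mul, Nat.add_zero, implies_true]
      intro r h1 h2
      have : r ≠ 3 * j + 3 := by omega
      simp [this]⟩ ?_
  · have hexec : exec g sim seed (avgCode j body i q) σ =
        exec g sim seed (.arith .div (3 * j + 3) (3 * j + 3) 2)
          ((List.range M).foldl (fun τ m => exec g sim seed inner
          { τ with idx := Function.update τ.idx (2 * j + 2) (m + 1), ops := τ.ops + 1 }) σ') := by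
      simp only [avgCode, exec, Nat.cast_zero]
      rw [show σ.idx 1 = M from hσ.reps]
      simp only [inner, exec, σ', Nat.cast_one]
    rw [hexec]
    generalize (List.range M).foldl (fun τ m => exec g sim seed inner
          { τ with idx := Function.update τ.idx (2 * j + 2) (m + 1), ops := τ.ops + 1 }) σ' = τ
      at key
    obtain ⟨hsum, hstep⟩ := key
    have h2 := hstep.real 2 (by omega) (by omega)
    refine ⟨?_, ?_⟩
    · simp [exec, Op.eval, hsum, h2, hσ.reps_real, avgMin, F]
    · constructor
      · intro r hr hr'
        have : r ≠ 3 * j + 3 := by omega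
        simp [exec, this, hstep.real r hr hr']
      · intro i hi
        simp [exec, hstep.idx i hi]
      · intro q hq
        simp [exec, hstep.path q hq]
      · simp [exec, hstep.calls]
      · simp [exec, hstep.evals]
      · simp [exec, hstep.ops]; ring
  rintro m hm τ ⟨hsum, hstep⟩
  have hti : τ.idx i = σ.idx i := hstep.idx i (by omega)
  have htq : τ.path q = σ.path q := hstep.path q (by omega)
  have hii : i ≠ 2 * j + 2 := by omega
  -- The memory just before the time loop of repetition `m`: continuation sampled, running minimum
  -- reset to `1`.
  let ρ : Memory D T := exec g sim seed (.seq (.sample j i q) (.const (3 * j + 4) 1))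
    { τ with idx := Function.update τ.idx (2 * j + 2) (m + 1), ops := τ.ops + 1 }
  have hρreal : ρ.real = Function.update τ.real (3 * j + 4) 1 := by simp [ρ, exec]
  have hρidx : ρ.idx = Function.update τ.idx (2 * j + 2) (m + 1) := by simp [ρ, exec]
  have hρpath : ρ.path = Function.update τ.path j
      (simAt sim (σ.idx i) (σ.path q) (shift σ.calls seed (m * (1 + T * c)))) := by
    have h := exec_sample_path (g := g) (sim := sim) (seed := seed) (p := j) (i := i) (q := q)
      { τ with idx := Function.update τ.idx (2 * j + 2) (m + 1), ops := τ.ops + 1 }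
      (by simpa [hii, hti] using ht)
    simp only [Function.update_of_ne hii, hti, htq] at h
    refine h.trans ?_
    rw [hstep.calls]
    rfl
  have hρcalls : ρ.calls = σ.calls + m * (1 + T * c) + 1 := by simp [ρ, exec, hstep.calls]
  have hρevals : ρ.evals = σ.evals + m * (T * e) := by simp [ρ, exec, hstep.evals]
  have hρops : ρ.ops = σ.ops + m * (2 + T * (o + 2)) + 1 := by simp [ρ, exec, hstep.ops]
  have hready : Ready M ρ := by
    refine ⟨?_, ?_, ?_⟩
    · simpa [hρidx, Function.update_apply, hσ.horizon] using hstep.idx 0 (by omega)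
    · simpa [hρidx, Function.update_apply, hσ.reps] using hstep.idx 1 (by omega)
    · simpa [hρreal, Function.update_apply, hσ.reps_real] using hstep.real 2 (by omega) (by omega)
  have hloop := exec_minLoop hbody ρ hready (by simp [hρreal])
  show p (m + 1) (exec g sim seed (.arith .add (3 * j + 3) (3 * j + 3) (3 * j + 4))
    (exec g sim seed (.loop (2 * j + 3) 0 <|
      .seq body (.arith .min (3 * j + 4) (3 * j + 4) (3 * j + 5))) ρ))
  generalize exec g sim seed (.loop (2 * j + 3) 0 <|
      .seq body (.arith .min (3 * j + 4) (3 * j + 4) (3 * j + 5))) ρ = κ at hloop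
  obtain ⟨hmin, hacc, -, hs⟩ := hloop
  refine ⟨?_, ?_⟩
  · rw [Finset.sum_range_succ, ← hsum]
    simp [exec, Op.eval, hmin, hacc, hρreal, hρpath, hρcalls, F, shift_shift]
    simp [add_assoc]
  · constructor
    · intro r hr hr'
      have h1 : r ≠ 3 * j + 3 := by omega
      have h2 : r ≠ 3 * j + 4 := by omega
      simp [exec, h1, h2, hs.real r hr hr', hρreal, hstep.real r hr hr']
    · intro i' hi'
      have h2 : i' ≠ 2 * j + 2 := by omega
      simp [exec, hs.idx i' hi', hρidx, h2, hstep.idx i' hi']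
    · intro q' hq'
      have h2 : q' ≠ j := by omega
      simp [exec, hs.path q' hq', hρpath, h2, hstep.path q' hq']
    · simp only [exec, hs.calls, hρcalls]; ring
    · simp only [exec, hs.evals, hρevals]; ring
    · simp only [exec, hs.ops, hρops]; ring

/-- The registers are quantified inside the induction because level `j + 1` runs the level `j` code
in two places: on the given path with result in `r`, and inside the average on the sampled path. -/
theorem computes_estCode (seed : ℕ → S) (M j : ℕ) : ∀ r i q : ℕ, 3 * j + 3 ≤ r → 2 * j + 2 ≤ i →
    j ≤ q → Computes g sim seed M j (callCount T M j) (evalCount T M j) (opCount T M j) r i q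
      (est g sim M j) (estCode j r i q) := by
  induction j with
  | zero =>
    intro r i q hr hi hq σ hσ h1 hT
    refine ⟨by simp [estCode, exec, est, payoffAt, h1, hT], ?_⟩
    constructor <;> simp +contextual [estCode, exec, h1, hT, callCount, evalCount, opCount]
  | succ j ih =>
    intro r i q hr hi hq σ hσ h1 hT
    obtain ⟨hv, hs⟩ := ih r i q (by omega) (by omega) (by omega) σ hσ h1 hT
    have hexec : exec g sim seed (estCode (j + 1) r i q) σ =
        exec g sim seed (.arith .sub r r (3 * j + 3))
          (exec g sim seed (avgCode j (estCode j (3 * j + 5) (2 * j + 3) j) i q)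
            (exec g sim seed (estCode j r i q) σ)) := rfl
    rw [hexec]
    generalize exec g sim seed (estCode j r i q) σ = τ at hv hs
    have hready : Ready M τ := by
      refine ⟨?_, ?_, ?_⟩
      · rw [hs.idx 0 (by omega), hσ.horizon]
      · rw [hs.idx 1 (by omega), hσ.reps]
      · rw [hs.real 2 (by omega) (by omega), hσ.reps_real]
    have hi' := hs.idx i (by omega)
    have hq' := hs.path q (by omega)
    obtain ⟨hv', hs'⟩ := exec_avgCode (i := i) (q := q) (by omega) (by omega)
      (ih (3 * j + 5) (2 * j + 3) j (by omega) (by omega) le_rfl) τ hready (hi'.trans_le hT)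
    generalize exec g sim seed (avgCode j (estCode j (3 * j + 5) (2 * j + 3) j) i q) τ = κ
      at hv' hs'
    refine ⟨?_, ?_⟩
    · have := hs'.real r (by omega) (by omega)
      simp [exec, Op.eval, hv', this, hv, est, hi', hq', hs.calls, shift_shift]
    · constructor
      · intro r' h2 h3
        rw [← hs.real r' h2 (by omega)]
        simpa [exec, h2] using hs'.real r' (by omega) (by omega)
      · intro i' h2
        simp [exec, hs'.idx i' h2, hs.idx i' (by omega)]
      · intro q' h2
        simp [exec, hs'.path q' h2, hs.path q' (by omega)]
      · simp [exec, hs'.calls, hs.calls, callCount]; ring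
      · simp [exec, hs'.evals, hs.evals, evalCount]; ring
      · simp [exec, hs'.ops, hs.ops, opCount]; ring

end Semantics

end NestedSim

namespace NestedSim

/-! ## The minimum with `1` -/

theorem runMin_le_one (f : ℕ → ℝ) (n : ℕ) : runMin f n ≤ 1 := by
  induction n with
  | zero => exact le_rfl
  | succ n ih => exact (min_le_left _ _).trans ih

theorem runMin_nonneg {f : ℕ → ℝ} {n : ℕ} (h : ∀ i < n, 0 ≤ f i) : 0 ≤ runMin f n := by
  induction n with
  | zero => exact zero_le_one
  | succ n ih =>
    exact le_min (ih fun i hi => h i (hi.trans n.lt_succ_self)) (h n n.lt_succ_self)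

/-- The minimum is 1-Lipschitz for the sup norm, so the error does not grow with the number of
terms. -/
theorem abs_runMin_sub_runMin_le {f g : ℕ → ℝ} {n : ℕ} {η : ℝ} (hη : 0 ≤ η)
    (h : ∀ i < n, |f i - g i| ≤ η) : |runMin f n - runMin g n| ≤ η := by
  induction n with
  | zero => simpa [runMin]
  | succ n ih =>
    refine (abs_min_sub_min_le_max _ _ _ _).trans (max_le ?_ (h n n.lt_succ_self))
    exact ih fun i hi => h i (hi.trans n.lt_succ_self)

theorem le_runMin_iff {f : ℕ → ℝ} {n : ℕ} {a : ℝ} :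
    a ≤ runMin f n ↔ a ≤ 1 ∧ ∀ i < n, a ≤ f i := by
  induction n with
  | zero => simp [runMin]
  | succ n ih => simp only [runMin, le_min_iff, ih, Nat.lt_succ_iff_lt_or_eq]; aesop

/-- The cap at `1` gives the upper bound needed for Hoeffding for free, and is harmless for terms in
`[0, 1]`. -/
theorem runMin_eq_iInf {f : ℕ → ℝ} {n : ℕ} (hn : 1 ≤ n) (h : ∀ i < n, f i ≤ 1) :
    runMin f n = ⨅ i : Fin n, f i := by
  have : Nonempty (Fin n) := ⟨⟨0, hn⟩⟩
  have hbdd : BddBelow (Set.range fun i : Fin n => f i) := (Set.finite_range _).bddBelow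
  apply le_antisymm
  · exact le_ciInf fun i => (le_runMin_iff.1 le_rfl).2 i i.2
  · refine le_runMin_iff.2 ⟨(ciInf_le hbdd ⟨0, hn⟩).trans (h 0 hn), fun i hi => ?_⟩
    exact ciInf_le hbdd ⟨i, hi⟩

theorem measurable_runMin {α : Type*} [MeasurableSpace α] {f : ℕ → α → ℝ} {n : ℕ}
    (h : ∀ i < n, Measurable (f i)) : Measurable fun x => runMin (fun i => f i x) n := by
  induction n with
  | zero => exact measurable_const
  | succ n ih =>
    exact (ih fun i hi => h i (hi.trans n.lt_succ_self)).min (h n n.lt_succ_self)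

/-! ## Sequences of independent seeds -/

section Seeds

variable {S : Type*} [MeasurableSpace S]

@[fun_prop]
theorem measurable_shift (a : ℕ) : Measurable (shift a : (ℕ → S) → ℕ → S) :=
  measurable_pi_lambda _ fun _ => measurable_pi_apply _

variable (ν : Measure S) [IsProbabilityMeasure ν]

theorem iIndepFun_eval_infinitePi :
    iIndepFun (fun (n : ℕ) (s : ℕ → S) => s n) (Measure.infinitePi fun _ : ℕ => ν) := by
  rw [iIndepFun_iff_map_fun_eq_infinitePi_map fun n => measurable_pi_apply n]
  simp [Measure.infinitePi_map_eval]

theorem measurePreserving_comp_injective {φ : ℕ → ℕ} (hφ : Function.Injective φ) :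
    MeasurePreserving (fun (s : ℕ → S) n => s (φ n)) (Measure.infinitePi fun _ : ℕ => ν)
      (Measure.infinitePi fun _ : ℕ => ν) := by
  refine ⟨by fun_prop, ?_⟩
  have h := (iIndepFun_iff_map_fun_eq_infinitePi_map fun n => measurable_pi_apply (φ n)).1
    ((iIndepFun_eval_infinitePi ν).precomp hφ)
  simpa [Measure.infinitePi_map_eval] using h

theorem measurePreserving_shift (a : ℕ) :
    MeasurePreserving (shift a : (ℕ → S) → ℕ → S) (Measure.infinitePi fun _ : ℕ => ν)
      (Measure.infinitePi fun _ : ℕ => ν) :=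
  measurePreserving_comp_injective ν (add_right_injective a)

/-- Prepending a seed is inverse to splitting off the first one, and it pushes the product law to
the i.i.d. law, as seen on cylinders. -/
theorem measurePreserving_head_tail :
    MeasurePreserving (fun s : ℕ → S => (s 0, shift 1 s)) (Measure.infinitePi fun _ : ℕ => ν)
      (ν.prod (Measure.infinitePi fun _ : ℕ => ν)) := by
  let cons : S × (ℕ → S) → ℕ → S := fun x n => Nat.casesOn n x.1 x.2
  have hcons : Measurable cons := by
    refine measurable_pi_lambda _ fun n => ?_
    cases n with
    | zero => exact measurable_fst
    | succ n => exact (measurable_pi_apply n).comp measurable_snd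
  have hlaw : (ν.prod (Measure.infinitePi fun _ : ℕ => ν)).map cons =
      Measure.infinitePi fun _ : ℕ => ν := by
    refine Measure.eq_infinitePi _ fun I t ht => ?_
    classical
    let t' : ℕ → Set S := fun n => if n ∈ I then t n else Set.univ
    have ht' (n : ℕ) : MeasurableSet (t' n) := by
      by_cases hn : n ∈ I <;> simp [t', hn, ht]
    obtain ⟨N, hN⟩ : ∃ N, I ⊆ Finset.range (N + 1) :=
      ⟨I.sup id, fun n hn => Finset.mem_range_succ_iff.2 (Finset.le_sup (f := id) hn)⟩
    have hpre : cons ⁻¹' Set.pi I t =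
        t' 0 ×ˢ Set.pi (Finset.range N) fun n => t' (n + 1) := by
      ext ⟨ξ, s⟩
      simp only [Set.mem_preimage, Set.mem_pi, Set.mem_prod, Finset.mem_coe, Finset.mem_range, t']
      constructor
      · intro h
        refine ⟨?_, fun n _ => ?_⟩
        · split_ifs with h0
          exacts [h 0 h0, trivial]
        · split_ifs with hn'
          exacts [h (n + 1) hn', trivial]
      · rintro ⟨h0, h1⟩ n hn
        cases n with
        | zero =>
          rw [if_pos hn] at h0
          exact h0
        | succ n =>
          have := h1 n (by simpa using hN hn)
          simpa [hn] using this
    have hprod : ∏ i ∈ I, ν (t i) = ∏ i ∈ Finset.range (N + 1), ν (t' i) := by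
      rw [← Finset.prod_subset hN]
      · exact Finset.prod_congr rfl fun i hi => by simp [t', hi]
      · intro i _ hi
        simp [t', hi]
    rw [Measure.map_apply hcons (MeasurableSet.pi I.countable_toSet fun i _ => ht i), hpre,
      Measure.prod_prod, Measure.infinitePi_pi _ fun i _ => ht' _, hprod, Finset.prod_range_succ',
      mul_comm]
  refine ⟨by fun_prop, ?_⟩
  rw [← hlaw, Measure.map_map (by fun_prop) hcons]
  have : (fun s : ℕ → S => (s 0, shift 1 s)) ∘ cons = id :=
    funext fun x => Prod.ext rfl <| funext fun n => by simp [shift, cons, Nat.add_comm 1]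
  rw [this, Measure.map_id, hlaw]

/-- A seed and a later stretch of seeds are independent. -/
theorem measurePreserving_eval_shift {a b : ℕ} (h : a < b) :
    MeasurePreserving (fun s : ℕ → S => (s a, shift b s)) (Measure.infinitePi fun _ : ℕ => ν)
      (ν.prod (Measure.infinitePi fun _ : ℕ => ν)) := by
  -- The reindexing `0 ↦ a`, `n + 1 ↦ b + n` is injective because `a < b`; splitting off the head
  -- then gives the claim.
  let φ : ℕ → ℕ := fun n => Nat.casesOn n a fun m => b + m
  have hφ : Function.Injective φ := by
    intro m n hmn
    cases m <;> cases n <;> simp [φ] at hmn ⊢ <;> omega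
  have := (measurePreserving_head_tail ν).comp (measurePreserving_comp_injective ν hφ)
  convert! this using 2 with s
  refine Prod.ext rfl (funext fun n => ?_)
  simp [φ, shift, Nat.add_comm 1]

/-- Hoeffding's inequality, two-sided, for averages of bounded functions of distinct seeds. -/
theorem measure_abs_average_sub_integral_gt_le {V : S → ℝ} (hV : Measurable V)
    (hb : ∀ᵐ ξ ∂ν, V ξ ∈ Set.Icc (0 : ℝ) 1) {φ : ℕ → ℕ} (hφ : Function.Injective φ) {M : ℕ}
    (hM : 0 < M) {η : ℝ} (hη : 0 ≤ η) :
    (Measure.infinitePi fun _ : ℕ => ν).real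
      {s | η < |(∑ m ∈ Finset.range M, V (s (φ m))) / M - ∫ ξ, V ξ ∂ν|} ≤
      2 * Real.exp (-2 * M * η ^ 2) := by
  set μ := Measure.infinitePi fun _ : ℕ => ν
  set I := ∫ ξ, V ξ ∂ν
  have hM' : (0 : ℝ) < M := by exact_mod_cast hM
  have hsub : HasSubgaussianMGF (fun ξ => V ξ - I) ((‖(1 : ℝ) - 0‖₊ / 2) ^ 2) ν :=
    hasSubgaussianMGF_of_mem_Icc hV.aemeasurable hb
  have hev (n : ℕ) : MeasurePreserving (fun s : ℕ → S => s n) μ ν :=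
    measurePreserving_eval_infinitePi (fun _ : ℕ => ν) n
  have hX (m : ℕ) : HasSubgaussianMGF (fun s : ℕ → S => V (s (φ m)) - I)
      ((‖(1 : ℝ) - 0‖₊ / 2) ^ 2) μ := by
    have h := hev (φ m)
    rw [← h.map_eq] at hsub
    exact hsub.of_map h.measurable.aemeasurable
  have hind : iIndepFun (fun m (s : ℕ → S) => V (s (φ m)) - I) μ :=
    ((iIndepFun_eval_infinitePi ν).precomp hφ).comp (fun _ ξ => V ξ - I)
      fun _ => hV.sub_const _
  have hind' : iIndepFun (fun m (s : ℕ → S) => -(V (s (φ m)) - I)) μ :=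
    hind.comp (fun _ x => -x) fun _ => measurable_neg
  have h1 := HasSubgaussianMGF.measure_sum_range_ge_le_of_iIndepFun hind (n := M)
    (fun i _ => hX i) (ε := M * η) (by positivity)
  have h2 := HasSubgaussianMGF.measure_sum_range_ge_le_of_iIndepFun hind' (n := M)
    (fun i _ => (hX i).neg) (ε := M * η) (by positivity)
  -- A variable with values in `[0, 1]` has variance proxy `1 / 4`.
  have hexp : -(M * η) ^ 2 / (2 * M * (((‖(1 : ℝ) - 0‖₊ / 2) ^ 2 : NNReal) : ℝ)) =
      -2 * M * η ^ 2 := by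
    simp
    field_simp
  rw [hexp] at h1 h2
  calc _ ≤ μ.real ({s | M * η ≤ ∑ m ∈ Finset.range M, (V (s (φ m)) - I)} ∪
        {s | M * η ≤ ∑ m ∈ Finset.range M, -(V (s (φ m)) - I)}) := by
        refine measureReal_mono fun s hs => ?_
        simp only [Set.mem_ofPred_eq, Set.mem_union] at hs ⊢
        rw [Finset.sum_neg_distrib, Finset.sum_sub_distrib, Finset.sum_const, Finset.card_range,
          nsmul_eq_mul]
        set A := ∑ m ∈ Finset.range M, V (s (φ m))
        have hA : A = M * (A / M) := by field_simp
        rcases lt_abs.1 hs with h | h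
        · left; rw [hA]; nlinarith
        · right; rw [hA]; nlinarith
    _ ≤ _ := (measureReal_union_le _ _).trans (by linarith)

end Seeds

end NestedSim

namespace NestedSim

/-! ## Accuracy of the estimator -/

section Accuracy

variable {S : Type*} [MeasurableSpace S] {T D : ℕ}

/-- The expected minimum, over a sampled continuation, of a process given as a function of the
path. -/
noncomputable def meanMin (sim : (t : ℕ) → Hist D t → S → Hist D T) (ν : Measure S)
    (z : ℕ → Hist D T → ℝ) (t : ℕ) (y : Hist D T) : ℝ :=
  ∫ ξ, runMin (fun i => z (i + 1) (simAt sim t y ξ)) T ∂ν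

/-- The process `Z^(j+1)` as a function of the path. -/
noncomputable def target (g : (t : ℕ) → Hist D t → ℝ) (sim : (t : ℕ) → Hist D t → S → Hist D T)
    (ν : Measure S) : ℕ → ℕ → Hist D T → ℝ
  | 0 => payoffAt g
  | j + 1 => fun t y => target g sim ν j t y - meanMin sim ν (target g sim ν j) t y

/-- The bound for the failure probability at level `j`, in terms of the failure probability `p`
of a single average. -/
noncomputable def failBound (T M : ℕ) (p : ℝ) : ℕ → ℝ
  | 0 => 0
  | j + 1 => failBound T M p j + (M * (T * failBound T M p j) + p)

theorem failBound_nonneg (T M : ℕ) {p : ℝ} (hp : 0 ≤ p) (j : ℕ) : 0 ≤ failBound T M p j := by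
  induction j with
  | zero => exact le_rfl
  | succ j ih => simp only [failBound]; positivity

@[fun_prop]
theorem measurable_firstCols {t : ℕ} (h : t ≤ T) :
    Measurable (firstCols h : Hist D T → Hist D t) :=
  measurable_pi_lambda _ fun _ => measurable_pi_apply _

theorem measurable_payoffAt {g : (t : ℕ) → Hist D t → ℝ} {t : ℕ} (h : t ≤ T)
    (hg : Measurable (g t)) : Measurable (payoffAt g t : Hist D T → ℝ) := by
  have : (payoffAt g t : Hist D T → ℝ) = fun y => g t (firstCols h y) := by
    funext y
    simp [payoffAt, h]
  rw [this]
  fun_prop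

variable {g : (t : ℕ) → Hist D t → ℝ} {sim : (t : ℕ) → Hist D t → S → Hist D T}

theorem measurable_simAt {t : ℕ} (h : t ≤ T)
    (hsim : Measurable fun x : Hist D t × S => sim t x.1 x.2) :
    Measurable fun x : Hist D T × S => simAt sim t x.1 x.2 := by
  simp only [simAt, h, dite_true]
  exact hsim.comp (((measurable_firstCols h).comp measurable_fst).prodMk measurable_snd)

variable {ν : Measure S} [IsProbabilityMeasure ν]

theorem measurable_meanMin {z : ℕ → Hist D T → ℝ} {t : ℕ}
    (hsim : Measurable fun x : Hist D T × S => simAt sim t x.1 x.2)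
    (hz : ∀ t, 1 ≤ t → t ≤ T → Measurable (z t)) : Measurable (meanMin sim ν z t) := by
  have h : Measurable fun x : Hist D T × S =>
      runMin (fun i => z (i + 1) (simAt sim t x.1 x.2)) T :=
    measurable_runMin fun i hi => (hz (i + 1) (by omega) (by omega)).comp hsim
  exact (h.stronglyMeasurable.integral_prod_right (ν := ν)).measurable

theorem measurable_target (hg : ∀ t, 1 ≤ t → t ≤ T → Measurable (g t))
    (hsim : ∀ t ≤ T, Measurable fun x : Hist D T × S => simAt sim t x.1 x.2) (j : ℕ) :
    ∀ t, 1 ≤ t → t ≤ T → Measurable (target g sim ν j t) := by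
  induction j with
  | zero => exact fun t h1 hT => measurable_payoffAt hT (hg t h1 hT)
  | succ j ih =>
    exact fun t h1 hT => (ih t h1 hT).sub (measurable_meanMin (hsim t hT) ih)

theorem measurable_avgMin {e : ℕ → Hist D T → (ℕ → S) → ℝ} {t : ℕ}
    (hsim : Measurable fun x : Hist D T × S => simAt sim t x.1 x.2)
    (he : ∀ t, 1 ≤ t → t ≤ T → Measurable fun x : Hist D T × (ℕ → S) => e t x.1 x.2) (M c : ℕ) :
    Measurable fun x : Hist D T × (ℕ → S) => avgMin sim M c e t x.1 x.2 := by
  refine Measurable.div_const (Finset.measurable_sum _ fun m _ => measurable_runMin fun i hi => ?_) _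
  refine (he (i + 1) (by omega) (by omega)).comp (Measurable.prodMk ?_ ?_)
  · exact hsim.comp (measurable_fst.prodMk ((measurable_pi_apply _).comp measurable_snd))
  · exact (measurable_shift _).comp measurable_snd

theorem measurable_avgMin_right {e : ℕ → Hist D T → (ℕ → S) → ℝ} {t : ℕ}
    (hsim : Measurable fun x : Hist D T × S => simAt sim t x.1 x.2)
    (he : ∀ t, 1 ≤ t → t ≤ T → Measurable fun x : Hist D T × (ℕ → S) => e t x.1 x.2) (M c : ℕ)
    (y : Hist D T) : Measurable fun s => avgMin sim M c e t y s :=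
  (measurable_avgMin hsim he M c).comp measurable_prodMk_left

theorem measurable_est (hg : ∀ t, 1 ≤ t → t ≤ T → Measurable (g t))
    (hsim : ∀ t ≤ T, Measurable fun x : Hist D T × S => simAt sim t x.1 x.2) (M j : ℕ) :
    ∀ t, 1 ≤ t → t ≤ T → Measurable fun x : Hist D T × (ℕ → S) => est g sim M j t x.1 x.2 := by
  induction j with
  | zero => exact fun t h1 hT => (measurable_payoffAt hT (hg t h1 hT)).comp measurable_fst
  | succ j ih =>
    intro t h1 hT
    have hmap : Measurable fun x : Hist D T × (ℕ → S) => (x.1, shift (callCount T M j) x.2) :=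
      measurable_fst.prodMk ((measurable_shift _).comp measurable_snd)
    have havg := (measurable_avgMin (hsim t hT) ih M (callCount T M j)).comp hmap
    simp only [est]
    exact (ih t h1 hT).sub havg

/-- Accuracy of an average of minima of estimators. -/
theorem avgMin_accuracy {e : ℕ → Hist D T → (ℕ → S) → ℝ} {z : ℕ → Hist D T → ℝ} {t : ℕ}
    (hsim : Measurable fun x : Hist D T × S => simAt sim t x.1 x.2)
    (he : ∀ t, 1 ≤ t → t ≤ T → Measurable fun x : Hist D T × (ℕ → S) => e t x.1 x.2)
    (hz : ∀ t, 1 ≤ t → t ≤ T → Measurable (z t))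
    {y : Hist D T} {a η p : ℝ} (ha : 0 ≤ a) (hη : 0 ≤ η) (hp : 0 ≤ p)
    (hnn : ∀ᵐ ξ ∂ν, ∀ i < T, 0 ≤ z (i + 1) (simAt sim t y ξ))
    (hacc : ∀ᵐ ξ ∂ν, ∀ i < T, (Measure.infinitePi fun _ : ℕ => ν).real
      {s | a < |e (i + 1) (simAt sim t y ξ) s - z (i + 1) (simAt sim t y ξ)|} ≤ p)
    {M : ℕ} (hM : 0 < M) (c : ℕ) :
    (Measure.infinitePi fun _ : ℕ => ν).real
      {s | a + η < |avgMin sim M c e t y s - meanMin sim ν z t y|} ≤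
      M * (T * p) + 2 * Real.exp (-2 * M * η ^ 2) := by
  set μ := Measure.infinitePi fun _ : ℕ => ν
  have hsimy : Measurable fun ξ => simAt sim t y ξ := hsim.comp measurable_prodMk_left
  let V : S → ℝ := fun ξ => runMin (fun i => z (i + 1) (simAt sim t y ξ)) T
  have hV : Measurable V :=
    measurable_runMin fun i hi => (hz (i + 1) (by omega) (by omega)).comp hsimy
  have hV01 : ∀ᵐ ξ ∂ν, V ξ ∈ Set.Icc (0 : ℝ) 1 := by
    filter_upwards [hnn] with ξ hξ using ⟨runMin_nonneg hξ, runMin_le_one _ _⟩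
  let b := 1 + T * c
  have hb : 0 < b := by positivity
  let W : ℕ → Set (S × (ℕ → S)) := fun i =>
    {x | a < |e (i + 1) (simAt sim t y x.1) x.2 - z (i + 1) (simAt sim t y x.1)|}
  have hW : ∀ i < T, MeasurableSet (W i) := by
    intro i hi
    refine measurableSet_lt measurable_const (Measurable.abs (Measurable.sub ?_ ?_))
    · exact (he (i + 1) (by omega) (by omega)).comp
        ((hsimy.comp measurable_fst).prodMk measurable_snd)
    · exact (hz (i + 1) (by omega) (by omega)).comp (hsimy.comp measurable_fst)
  -- The event that the inner estimate at time `i + 1` in repetition `m` is off by more than `a`.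
  -- The continuation's seed precedes the estimator's seeds and is independent of them, so Fubini
  -- bounds the probability by `p`. These events may be dependent on each other; only a union bound
  -- is used.
  let B : ℕ → ℕ → Set (ℕ → S) := fun m i =>
    (fun s : ℕ → S => (s (m * b), shift (m * b + 1 + i * c) s)) ⁻¹' W i
  have hB : ∀ m, ∀ i < T, μ.real (B m i) ≤ p := by
    intro m i hi
    have hpres := measurePreserving_eval_shift ν
      (show m * b < m * b + 1 + i * c by omega)
    rw [Measure.real, hpres.measure_preimage (hW i hi).nullMeasurableSet,
      Measure.prod_apply (hW i hi)]
    refine ENNReal.toReal_le_of_le_ofReal hp ?_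
    calc _ ≤ ∫⁻ _, ENNReal.ofReal p ∂ν := by
          refine lintegral_mono_ae ?_
          filter_upwards [hacc] with ξ hξ
          have := hξ i hi
          rw [Measure.real] at this
          exact (ENNReal.le_ofReal_iff_toReal_le (measure_ne_top _ _) hp).2 this
      _ = ENNReal.ofReal p := by simp
  -- The Hoeffding event concerns the true minima along the sampled continuations, whose seeds sit
  -- at the distinct positions `m * b`.
  let H : Set (ℕ → S) :=
    {s | η < |(∑ m ∈ Finset.range M, V (s (m * b))) / M - ∫ ξ, V ξ ∂ν|}
  have hH : μ.real H ≤ 2 * Real.exp (-2 * M * η ^ 2) :=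
    measure_abs_average_sub_integral_gt_le ν hV hV01 (mul_left_injective₀ hb.ne') hM hη
  have hM' : (0 : ℝ) < M := by exact_mod_cast hM
  have hsub : {s | a + η < |avgMin sim M c e t y s - meanMin sim ν z t y|} ⊆
      (⋃ m ∈ Finset.range M, ⋃ i ∈ Finset.range T, B m i) ∪ H := by
    intro s hs
    by_contra hcon
    simp only [Set.mem_union, Set.mem_iUnion, not_or, not_exists, Finset.mem_range] at hcon
    obtain ⟨h1, h2⟩ := hcon
    have h3 : |(∑ m ∈ Finset.range M, V (s (m * b))) / M - ∫ ξ, V ξ ∂ν| ≤ η := not_lt.1 h2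
    have h4 : |avgMin sim M c e t y s - (∑ m ∈ Finset.range M, V (s (m * b))) / M| ≤ a := by
      rw [avgMin, ← sub_div, ← Finset.sum_sub_distrib, abs_div, abs_of_pos hM', div_le_iff₀ hM']
      refine (Finset.abs_sum_le_sum_abs _ _).trans ?_
      calc _ ≤ ∑ _m ∈ Finset.range M, a := by
            refine Finset.sum_le_sum fun m hm => abs_runMin_sub_runMin_le ha fun i hi => ?_
            exact not_lt.1 (h1 m (Finset.mem_range.1 hm) i hi)
        _ = a * M := by simp [mul_comm]
    have h5 := abs_sub_le (avgMin sim M c e t y s) ((∑ m ∈ Finset.range M, V (s (m * b))) / M)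
      (∫ ξ, V ξ ∂ν)
    have h6 : a + η < |avgMin sim M c e t y s - ∫ ξ, V ξ ∂ν| := hs
    linarith
  calc _ ≤ μ.real ((⋃ m ∈ Finset.range M, ⋃ i ∈ Finset.range T, B m i) ∪ H) :=
        measureReal_mono hsub
    _ ≤ μ.real (⋃ m ∈ Finset.range M, ⋃ i ∈ Finset.range T, B m i) + μ.real H :=
        measureReal_union_le _ _
    _ ≤ ∑ _m ∈ Finset.range M, ∑ _i ∈ Finset.range T, p + μ.real H := by
        gcongr
        refine (measureReal_biUnion_finset_le _ _).trans (Finset.sum_le_sum fun m _ => ?_)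
        refine (measureReal_biUnion_finset_le _ _).trans (Finset.sum_le_sum fun i hi => ?_)
        exact hB m i (Finset.mem_range.1 hi)
    _ ≤ _ := by simpa using hH

/-- Accuracy of the level `j` estimator, for almost every history. -/
theorem est_accuracy (hg : ∀ t, 1 ≤ t → t ≤ T → Measurable (g t))
    (hsim : ∀ t ≤ T, Measurable fun x : Hist D T × S => simAt sim t x.1 x.2)
    {L : Measure (Hist D T)}
    (hL : ∀ t ≤ T, ∀ Q : Hist D T → Prop, (∀ᵐ y ∂L, Q y) →
      ∀ᵐ y ∂L, ∀ᵐ ξ ∂ν, Q (simAt sim t y ξ))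
    (hnn : ∀ j, ∀ᵐ y ∂L, ∀ i < T, 0 ≤ target g sim ν j (i + 1) y)
    {M : ℕ} (hM : 0 < M) {η : ℝ} (hη : 0 ≤ η) (j : ℕ) :
    ∀ᵐ y ∂L, ∀ i < T, (Measure.infinitePi fun _ : ℕ => ν).real
      {s | (2 ^ j - 1) * η < |est g sim M j (i + 1) y s - target g sim ν j (i + 1) y|} ≤
      failBound T M (2 * Real.exp (-2 * M * η ^ 2)) j := by
  set p := 2 * Real.exp (-2 * M * η ^ 2)
  have hp : 0 ≤ p := by positivity
  induction j with
  | zero => simp [est, target, failBound]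
  | succ j ih =>
    have hpow : (1 : ℝ) ≤ 2 ^ j := one_le_pow₀ one_le_two
    have havg : ∀ᵐ y ∂L, ∀ i < T, (Measure.infinitePi fun _ : ℕ => ν).real
        {s | (2 ^ j - 1) * η + η < |avgMin sim M (callCount T M j) (est g sim M j) (i + 1) y s -
          meanMin sim ν (target g sim ν j) (i + 1) y|} ≤ M * (T * failBound T M p j) + p := by
      refine ae_all_iff.2 fun i => ?_
      by_cases hi : i < T
      swap
      · exact Filter.Eventually.of_forall fun y h => absurd h hi
      filter_upwards [hL (i + 1) hi _ ih, hL (i + 1) hi _ (hnn j)] with y h1 h2 _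
      exact avgMin_accuracy (hsim _ hi) (measurable_est hg hsim M j) (measurable_target hg hsim j)
        (by nlinarith) hη (failBound_nonneg _ _ hp _) h2 h1 hM _
    filter_upwards [ih, havg] with y h1 h2 i hi
    refine le_trans ?_ (add_le_add (h1 i hi) (h2 i hi))
    -- The average reads the seeds following those of the first estimate; discarding an initial
    -- stretch does not change the law.
    have hshift := (measurePreserving_shift ν (callCount T M j)).measureReal_preimage
      (s := {s | (2 ^ j - 1) * η + η < |avgMin sim M (callCount T M j) (est g sim M j) (i + 1) y s -
          meanMin sim ν (target g sim ν j) (i + 1) y|}) ?_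
    swap
    · refine (measurableSet_lt measurable_const (Measurable.abs (Measurable.sub ?_
        measurable_const))).nullMeasurableSet
      exact measurable_avgMin_right (hsim _ hi) (measurable_est hg hsim M j) M _ y
    rw [← hshift]
    refine le_trans (measureReal_mono ?_) (measureReal_union_le _ _)
    intro s hs
    by_contra hcon
    simp only [Set.mem_union, not_or, Set.mem_preimage, Set.mem_ofPred_eq, not_lt] at hcon hs
    simp only [est, target] at hs
    -- The error splits into that of the level `j` estimate and that of the average: `(2 ^ j - 1) η
    -- + 2 ^ j η = (2 ^ (j + 1) - 1) η`.
    rw [sub_sub_sub_comm] at hs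
    have := hs.trans_le (abs_sub _ _)
    rw [pow_succ] at this
    linarith [hcon.1, hcon.2]

end Accuracy

end NestedSim

namespace NestedSim

/-! ## The level processes as functions of the path -/

section Transfer

set_option linter.unusedSectionVars false

variable {Ω S : Type*} [MeasurableSpace Ω] [MeasurableSpace S] {T D : ℕ}
  {P : Measure Ω} [IsProbabilityMeasure P] {Y : Ω → Hist D T}
  {g : (t : ℕ) → Hist D t → ℝ} {ν : Measure S} [IsProbabilityMeasure ν]
  {sim : (t : ℕ) → Hist D t → S → Hist D T}

theorem IsSimulator.measurable_simAt (hsim : IsSimulator P Y ν sim) {t : ℕ} (ht : t ≤ T) :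
    Measurable fun x : Hist D T × S => simAt sim t x.1 x.2 :=
  NestedSim.measurable_simAt ht (hsim.measurable_sim t ht)

theorem IsSimulator.ae_map_simAt (hsim : IsSimulator P Y ν sim) (hY : Measurable Y) {t : ℕ}
    (ht : t ≤ T) : ∀ᵐ ω ∂P, ν.map (simAt sim t (Y ω)) =
      condDistrib Y (fun ω => firstCols ht (Y ω)) P (firstCols ht (Y ω)) := by
  have hX : Measurable fun ω => firstCols ht (Y ω) := (measurable_firstCols ht).comp hY
  filter_upwards [ae_of_ae_map hX.aemeasurable (hsim.law_sim t ht)] with ω hω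
  rw [← hω]
  congr 1
  funext ξ
  simp [simAt, ht]

/-- Almost sure properties of the process hold for sampled continuations of almost every
history. -/
theorem IsSimulator.ae_ae_simAt (hsim : IsSimulator P Y ν sim) (hY : Measurable Y) {t : ℕ}
    (ht : t ≤ T) {Q : Hist D T → Prop} (hQ : ∀ᵐ y ∂P.map Y, Q y) :
    ∀ᵐ y ∂P.map Y, ∀ᵐ ξ ∂ν, Q (simAt sim t y ξ) := by
  have hX : Measurable fun ω => firstCols ht (Y ω) := (measurable_firstCols ht).comp hY
  -- The law of `Y` is the mixture of its conditional laws, so a null set is null for almost every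
  -- one of them.
  rw [← condDistrib_comp_map hX.aemeasurable hY.aemeasurable] at hQ
  have h1 := Measure.ae_ae_of_ae_comp hQ
  have h2 : ∀ᵐ γ ∂P.map fun ω => firstCols ht (Y ω), ∀ᵐ ξ ∂ν, Q (sim t γ ξ) := by
    filter_upwards [h1, hsim.law_sim t ht] with γ h3 h4
    rw [← h4] at h3
    exact ae_of_ae_map ((hsim.measurable_sim t ht).comp measurable_prodMk_left).aemeasurable h3
  rw [show (fun ω => firstCols ht (Y ω)) = firstCols ht ∘ Y from rfl,
    ← Measure.map_map (measurable_firstCols ht) hY] at h2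
  filter_upwards [ae_of_ae_map (measurable_firstCols ht).aemeasurable h2] with y hy
  simpa only [simAt, ht, dite_true] using hy

theorem IsSimulator.condExp_ae_eq (hsim : IsSimulator P Y ν sim) (hY : Measurable Y) {t : ℕ}
    (ht : t ≤ T) {h : Hist D T → ℝ} (hh : Measurable h) (hint : Integrable (fun ω => h (Y ω)) P) :
    P[fun ω => h (Y ω) |
        MeasurableSpace.comap (fun ω => firstCols ht (Y ω)) inferInstance] =ᵐ[P]
      fun ω => ∫ ξ, h (simAt sim t (Y ω) ξ) ∂ν := by
  have hX : Measurable fun ω => firstCols ht (Y ω) := (measurable_firstCols ht).comp hY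
  filter_upwards [condExp_ae_eq_integral_condDistrib hX hY.aemeasurable hh.stronglyMeasurable hint,
    hsim.ae_map_simAt hY ht] with ω h1 h2
  rw [h1, ← h2, integral_map]
  · exact ((hsim.measurable_simAt ht).comp measurable_prodMk_left).aemeasurable
  · exact hh.aestronglyMeasurable

theorem pastSigma_le (hY : Measurable Y) (i : Fin T) : pastSigma Y i ≤ ‹MeasurableSpace Ω› :=
  ((measurable_firstCols _).comp hY).comap_le

theorem measurable_iInf_levelProc (hY : Measurable Y) {k : ℕ}
    (h : ∀ i, StronglyMeasurable[pastSigma Y i] (levelProc P Y g k i)) :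
    Measurable fun ω => ⨅ i : Fin T, levelProc P Y g k i ω :=
  Measurable.iInf fun i => ((h i).mono (pastSigma_le hY i)).measurable

theorem iInf_mem_Icc (hT : 1 ≤ T) {f : Fin T → ℝ} (h : ∀ i, f i ∈ Set.Icc (0 : ℝ) 1) :
    ⨅ i, f i ∈ Set.Icc (0 : ℝ) 1 := by
  have : Nonempty (Fin T) := ⟨⟨0, hT⟩⟩
  exact ⟨le_ciInf fun i => (h i).1,
    (ciInf_le (Set.finite_range _).bddBelow ⟨0, hT⟩).trans (h _).2⟩

theorem stronglyMeasurable_levelProc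
    (hg : ∀ t, 1 ≤ t → t ≤ T → Measurable (g t)) (j : ℕ) :
    ∀ i, StronglyMeasurable[pastSigma Y i] (levelProc P Y g (j + 1) i) := by
  induction j with
  | zero =>
    intro i
    have h : Measurable[pastSigma Y i] fun ω => firstCols (Nat.succ_le_of_lt i.isLt) (Y ω) :=
      comap_measurable _
    exact ((hg (i + 1) (by omega) i.isLt).comp h).stronglyMeasurable
  | succ j ih => exact fun i => (ih i).sub stronglyMeasurable_condExp

/-- Since `min_i Z_i ≤ Z_t` and `Z_t` is `F_t`-measurable, `E[min_i Z_i | F_t] ≤ Z_t`, so the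
difference is nonnegative; it is at most `Z_t` because the subtracted term is nonnegative. -/
theorem levelProc_mem_Icc (hY : Measurable Y)
    (hg : ∀ t, 1 ≤ t → t ≤ T → Measurable (g t)) (hT : 1 ≤ T)
    (hZ : ∀ᵐ ω ∂P, ∀ i : Fin T, payoffProc Y g i ω ∈ Set.Icc (0 : ℝ) 1) (j : ℕ) :
    ∀ᵐ ω ∂P, ∀ i, levelProc P Y g (j + 1) i ω ∈ Set.Icc (0 : ℝ) 1 := by
  induction j with
  | zero => exact hZ
  | succ j ih =>
    have hmeas := stronglyMeasurable_levelProc (P := P) (Y := Y) hg j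
    have hm01 : ∀ᵐ ω ∂P, ⨅ i : Fin T, levelProc P Y g (j + 1) i ω ∈ Set.Icc (0 : ℝ) 1 :=
      ih.mono fun ω hω => iInf_mem_Icc hT hω
    have hint : Integrable (fun ω => ⨅ i : Fin T, levelProc P Y g (j + 1) i ω) P :=
      Integrable.of_mem_Icc 0 1 (measurable_iInf_levelProc hY hmeas).aemeasurable hm01
    refine ae_all_iff.2 fun i => ?_
    have hint' : Integrable (levelProc P Y g (j + 1) i) P :=
      Integrable.of_mem_Icc 0 1 ((hmeas i).mono (pastSigma_le hY i)).measurable.aemeasurable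
        (ih.mono fun ω hω => hω i)
    have h1 : P[fun ω => ⨅ i : Fin T, levelProc P Y g (j + 1) i ω | pastSigma Y i] ≤ᵐ[P]
        P[levelProc P Y g (j + 1) i | pastSigma Y i] :=
      condExp_mono hint hint' (Filter.Eventually.of_forall fun ω =>
        ciInf_le (Set.finite_range fun i => levelProc P Y g (j + 1) i ω).bddBelow i)
    rw [condExp_of_stronglyMeasurable (pastSigma_le hY i) (hmeas i) hint'] at h1
    have h2 : 0 ≤ᵐ[P] P[fun ω => ⨅ i : Fin T, levelProc P Y g (j + 1) i ω | pastSigma Y i] :=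
      condExp_nonneg (hm01.mono fun ω hω => hω.1)
    filter_upwards [ih, h1, h2] with ω h3 h4 h5
    simp only [levelProc, Set.mem_Icc]
    exact ⟨sub_nonneg.2 h4, (sub_le_self _ h5).trans (h3 i).2⟩

/-- The minimum over time of the process `Z^(j+1)` as a function of the path. -/
noncomputable def targetMin (g : (t : ℕ) → Hist D t → ℝ)
    (sim : (t : ℕ) → Hist D t → S → Hist D T) (ν : Measure S) (j : ℕ) (y : Hist D T) : ℝ :=
  runMin (fun i => target g sim ν j (i + 1) y) T

theorem iInf_levelProc_ae_eq (hT : 1 ≤ T) {j : ℕ}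
    (h01 : ∀ᵐ ω ∂P, ∀ i, levelProc P Y g (j + 1) i ω ∈ Set.Icc (0 : ℝ) 1)
    (heq : ∀ᵐ ω ∂P, ∀ i : Fin T, levelProc P Y g (j + 1) i ω = target g sim ν j (i + 1) (Y ω)) :
    (fun ω => ⨅ i : Fin T, levelProc P Y g (j + 1) i ω) =ᵐ[P]
      fun ω => targetMin g sim ν j (Y ω) := by
  filter_upwards [h01, heq] with ω h1 h2
  rw [targetMin, runMin_eq_iInf hT]
  · exact iInf_congr h2
  · exact fun i hi => (h2 ⟨i, hi⟩).symm.trans_le (h1 ⟨i, hi⟩).2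

theorem levelProc_ae_eq_target (hY : Measurable Y)
    (hg : ∀ t, 1 ≤ t → t ≤ T → Measurable (g t)) (hT : 1 ≤ T)
    (hZ : ∀ᵐ ω ∂P, ∀ i : Fin T, payoffProc Y g i ω ∈ Set.Icc (0 : ℝ) 1)
    (hsim : IsSimulator P Y ν sim) (j : ℕ) :
    ∀ᵐ ω ∂P, ∀ i : Fin T, levelProc P Y g (j + 1) i ω = target g sim ν j (i + 1) (Y ω) := by
  induction j with
  | zero =>
    refine Filter.Eventually.of_forall fun ω i => ?_
    have : (i : ℕ) + 1 ≤ T := i.isLt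
    simp [levelProc, payoffProc, target, payoffAt, this]
  | succ j ih =>
    have h01 := levelProc_mem_Icc hY hg hT hZ j
    have hmin := iInf_levelProc_ae_eq hT h01 ih
    have hmeas : Measurable (targetMin g sim ν j) := measurable_runMin fun i hi =>
      measurable_target hg (fun t ht => hsim.measurable_simAt ht) j (i + 1) (by omega) (by omega)
    have hint : Integrable (fun ω => targetMin g sim ν j (Y ω)) P := by
      refine Integrable.of_mem_Icc 0 1 (hmeas.comp hY).aemeasurable ?_
      filter_upwards [h01, hmin] with ω h1 h2
      rw [← h2]
      exact iInf_mem_Icc hT h1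
    refine ae_all_iff.2 fun i => ?_
    filter_upwards [ih, condExp_congr_ae (m := pastSigma Y i) hmin,
      hsim.condExp_ae_eq hY (Nat.succ_le_of_lt i.isLt) hmeas hint] with ω h1 h2 h3
    simp only [levelProc, target]
    rw [h1 i, h2, h3]
    rfl

theorem target_nonneg (hY : Measurable Y)
    (hg : ∀ t, 1 ≤ t → t ≤ T → Measurable (g t)) (hT : 1 ≤ T)
    (hZ : ∀ᵐ ω ∂P, ∀ i : Fin T, payoffProc Y g i ω ∈ Set.Icc (0 : ℝ) 1)
    (hsim : IsSimulator P Y ν sim) (j : ℕ) :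
    ∀ᵐ y ∂P.map Y, ∀ i < T, 0 ≤ target g sim ν j (i + 1) y := by
  have hmeas : ∀ i < T, Measurable (target g sim ν j (i + 1)) := fun i hi =>
    measurable_target hg (fun t ht => hsim.measurable_simAt ht) j (i + 1) (by omega) (by omega)
  have hset : MeasurableSet {y | ∀ i < T, 0 ≤ target g sim ν j (i + 1) y} := by
    have : {y | ∀ i < T, 0 ≤ target g sim ν j (i + 1) y} =
        ⋂ i ∈ Finset.range T, {y | 0 ≤ target g sim ν j (i + 1) y} := by ext; simp
    rw [this]
    exact Finset.measurableSet_biInter _ fun i hi =>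
      measurableSet_le measurable_const (hmeas i (Finset.mem_range.1 hi))
  rw [ae_map_iff hY.aemeasurable hset]
  filter_upwards [levelProc_mem_Icc hY hg hT hZ j, levelProc_ae_eq_target hY hg hT hZ hsim j]
    with ω h1 h2 i hi
  exact (h1 ⟨i, hi⟩).1.trans_eq (h2 ⟨i, hi⟩)

/-- A history without columns carries no information. This lets statements valid for almost every
path be used at the particular path `0` in memory, which may lie in a null set. -/
theorem simAt_zero (sim : (t : ℕ) → Hist D t → S → Hist D T) (y y' : Hist D T) :
    simAt sim 0 y = simAt sim 0 y' := by
  funext ξ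
  simp only [simAt, Nat.zero_le, dite_true]
  rw [Subsingleton.elim (firstCols (Nat.zero_le T) y) (firstCols (Nat.zero_le T) y')]

theorem levelValue_eq_meanMin (hY : Measurable Y)
    (hg : ∀ t, 1 ≤ t → t ≤ T → Measurable (g t)) (hT : 1 ≤ T)
    (hZ : ∀ᵐ ω ∂P, ∀ i : Fin T, payoffProc Y g i ω ∈ Set.Icc (0 : ℝ) 1)
    (hsim : IsSimulator P Y ν sim) (j : ℕ) (y : Hist D T) :
    levelValue P Y g (j + 1) = meanMin sim ν (target g sim ν j) 0 y := by
  have h01 := levelProc_mem_Icc hY hg hT hZ j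
  have hmin := iInf_levelProc_ae_eq hT h01 (levelProc_ae_eq_target hY hg hT hZ hsim j)
  have hmeas : Measurable (targetMin g sim ν j) := measurable_runMin fun i hi =>
    measurable_target hg (fun t ht => hsim.measurable_simAt ht) j (i + 1) (by omega) (by omega)
  have hint : Integrable (fun ω => targetMin g sim ν j (Y ω)) P := by
    refine Integrable.of_mem_Icc 0 1 (hmeas.comp hY).aemeasurable ?_
    filter_upwards [h01, hmin] with ω h1 h2
    rw [← h2]
    exact iInf_mem_Icc hT h1
  have hX : Measurable fun ω => firstCols (Nat.zero_le T) (Y ω) :=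
    (measurable_firstCols _).comp hY
  rw [levelValue, integral_congr_ae hmin, ← integral_condExp hX.comap_le,
    integral_congr_ae (hsim.condExp_ae_eq hY (Nat.zero_le T) hmeas hint)]
  simp_rw [fun ω => simAt_zero sim (Y ω) y]
  simp [meanMin, targetMin]

/-- Accuracy of the average for `H_(j+1)`. -/
theorem avgMin_est_accuracy (hY : Measurable Y)
    (hg : ∀ t, 1 ≤ t → t ≤ T → Measurable (g t)) (hT : 1 ≤ T)
    (hZ : ∀ᵐ ω ∂P, ∀ i : Fin T, payoffProc Y g i ω ∈ Set.Icc (0 : ℝ) 1)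
    (hsim : IsSimulator P Y ν sim) {M : ℕ} (hM : 0 < M) {η : ℝ} (hη : 0 ≤ η) (j : ℕ)
    (y : Hist D T) :
    (Measure.infinitePi fun _ : ℕ => ν).real {s | 2 ^ j * η <
        |avgMin sim M (callCount T M j) (est g sim M j) 0 y s - levelValue P Y g (j + 1)|} ≤
      M * (T * failBound T M (2 * Real.exp (-2 * M * η ^ 2)) j)
        + 2 * Real.exp (-2 * M * η ^ 2) := by
  have hsm : ∀ t ≤ T, Measurable fun x : Hist D T × S => simAt sim t x.1 x.2 :=
    fun t ht => hsim.measurable_simAt ht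
  have hnn := target_nonneg hY hg hT hZ hsim
  have hacc := est_accuracy hg hsm (fun t ht Q hQ => hsim.ae_ae_simAt hY ht hQ) hnn hM hη j
  have hprob : IsProbabilityMeasure (P.map Y) := Measure.isProbabilityMeasure_map hY.aemeasurable
  -- Some path is good because the law of `Y` is a probability measure, and at time `0` any path may
  -- replace it.
  obtain ⟨y', h1, h2⟩ := ((hsim.ae_ae_simAt hY (Nat.zero_le T) hacc).and
    (hsim.ae_ae_simAt hY (Nat.zero_le T) (hnn j))).exists
  rw [simAt_zero sim y' y] at h1 h2
  have hpow : (1 : ℝ) ≤ 2 ^ j := one_le_pow₀ one_le_two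
  have := avgMin_accuracy (hsm 0 (Nat.zero_le T)) (measurable_est hg hsm M j)
    (measurable_target hg hsm j) (by nlinarith) hη (failBound_nonneg _ _ (by positivity) _)
    h2 h1 hM (callCount T M j)
  rw [levelValue_eq_meanMin hY hg hT hZ hsim j y]
  convert this using 5
  ring

end Transfer

end NestedSim

namespace NestedSim

/-! ## The complete program -/

/-- The number of repetitions per average. -/
noncomputable def reps (T j : ℕ) (ε δ : ℝ) : ℕ :=
  ⌈(Real.log (T / δ / ε) + 1) * (20 ^ (j + 1) : ℕ) / ε / ε⌉₊

/-- Code which stores the number of repetitions in index register `1` and real register `2`. -/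
def repsCode (j : ℕ) : Code :=
  .seq (.cast 3 0) <| .seq (.arith .div 3 3 1) <| .seq (.arith .div 3 3 0) <| .seq (.log 3 3) <|
  .seq (.const 4 1) <| .seq (.arith .add 3 3 4) <|
  .seq (.const 4 (20 ^ (j + 1))) <| .seq (.arith .mul 3 3 4) <|
  .seq (.arith .div 3 3 0) <| .seq (.arith .div 3 3 0) <| .seq (.ceil 1 3) <| .cast 2 1

/-- The program for `H_(j+1)`. -/
def program (j : ℕ) : Code :=
  .seq (repsCode j) <|
  .seq (avgCode j (estCode j (3 * j + 5) (2 * j + 3) j) (2 * j + 4) (j + 1)) <|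
  .copy 0 (3 * j + 3)

section Program

variable {S : Type*} {T D : ℕ}

theorem run_program (g : (t : ℕ) → Hist D t → ℝ) (sim : (t : ℕ) → Hist D t → S → Hist D T)
    (j : ℕ) (ε δ : ℝ) (seed : ℕ → S) {M : ℕ} (hM : reps T j ε δ = M) :
    (run g sim (program j) ε δ seed).output =
        avgMin sim M (callCount T M j) (est g sim M j) 0 0 seed ∧
      (run g sim (program j) ε δ seed).calls = M * (1 + T * callCount T M j) ∧
      (run g sim (program j) ε δ seed).evals = M * (T * evalCount T M j) ∧
      (run g sim (program j) ε δ seed).ops = M * (2 + T * (opCount T M j + 2)) + 9 := by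
  let σ : Memory D T := exec g sim seed (repsCode j) (initMemory D T ε δ)
  have hidx : σ.idx = Function.update (fun i => if i = 0 then T else 0) 1 M := by
    -- `reps` is written with the very operations of `repsCode`, in the same order.
    simp [σ, repsCode, exec, initMemory, Op.eval, ← hM, reps]
  have hready : Ready M σ := by
    refine ⟨by simp [hidx], by simp [hidx], ?_⟩
    simp [σ, repsCode, exec, initMemory, Op.eval, ← hM, reps]
  have hcalls : σ.calls = 0 := by simp [σ, repsCode, exec, initMemory]
  have hevals : σ.evals = 0 := by simp [σ, repsCode, exec, initMemory]
  have hops : σ.ops = 8 := by simp [σ, repsCode, exec, initMemory]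
  have hpath : σ.path = fun _ => 0 := by simp [σ, repsCode, exec, initMemory]
  -- This index register is never written, so its initial `0` makes the outermost query
  -- unconditioned.
  have hi : σ.idx (2 * j + 4) = 0 := by simp [hidx]
  obtain ⟨hv, hs⟩ := exec_avgCode (i := 2 * j + 4) (q := j + 1) (by omega) (by omega)
    (computes_estCode (g := g) (sim := sim) seed M j (3 * j + 5) (2 * j + 3) j
      (by omega) (by omega) le_rfl) σ hready (by omega)
  have hrun : run g sim (program j) ε δ seed = exec g sim seed (.copy 0 (3 * j + 3))
      (exec g sim seed (avgCode j (estCode j (3 * j + 5) (2 * j + 3) j) (2 * j + 4) (j + 1)) σ) :=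
    rfl
  rw [hrun]
  generalize exec g sim seed
    (avgCode j (estCode j (3 * j + 5) (2 * j + 3) j) (2 * j + 4) (j + 1)) σ = τ at hv hs
  have hshift : shift 0 seed = seed := funext fun n => by simp [shift]
  rw [hcalls, hshift, hi, hpath] at hv
  refine ⟨by simpa [exec, Memory.output] using hv, ?_, ?_, ?_⟩
  · simp [exec, hs.calls, hcalls]
  · simp [exec, hs.evals, hevals]
  · simp [exec, hs.ops, hops]; ring

end Program

/-! ## Cost -/

/-- The summand `1` (here, and `2` for operations, `p` for failure bounds) absorbs the inhomogeneous
terms, leaving a pure factor `M * (T + 2)` per level. -/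
theorem callCount_succ_le {T M : ℕ} (hM : 1 ≤ M) (j : ℕ) :
    callCount T M j + 1 ≤ (M * (T + 2)) ^ j := by
  induction j with
  | zero => simp [callCount]
  | succ j ih =>
    calc callCount T M (j + 1) + 1
        ≤ (callCount T M j + 1) * (M * (T + 2)) := by simp only [callCount]; nlinarith
      _ ≤ _ := by rw [pow_succ]; gcongr

theorem evalCount_le {T M : ℕ} (hM : 1 ≤ M) (j : ℕ) : evalCount T M j ≤ (M * (T + 2)) ^ j := by
  induction j with
  | zero => simp [evalCount]
  | succ j ih =>
    calc evalCount T M (j + 1) ≤ evalCount T M j * (M * (T + 2)) := by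
          simp only [evalCount]; nlinarith
      _ ≤ _ := by rw [pow_succ]; gcongr

theorem opCount_add_two_le {T M : ℕ} (hM : 2 ≤ M) (j : ℕ) :
    opCount T M j + 2 ≤ 2 * (M * (T + 2)) ^ j := by
  induction j with
  | zero => simp [opCount]
  | succ j ih =>
    calc opCount T M (j + 1) + 2 ≤ (opCount T M j + 2) * (M * (T + 2)) := by
          simp only [opCount]; nlinarith
      _ ≤ 2 * (M * (T + 2)) ^ j * (M * (T + 2)) := by gcongr
      _ = _ := by rw [pow_succ]; ring

theorem program_cost_le {T M : ℕ} (hM : 5 ≤ M) (j : ℕ) :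
    M * (1 + T * callCount T M j) ≤ 2 * (M * (T + 2)) ^ (j + 1) ∧
      M * (T * evalCount T M j) ≤ 2 * (M * (T + 2)) ^ (j + 1) ∧
      M * (2 + T * (opCount T M j + 2)) + 9 ≤ 2 * (M * (T + 2)) ^ (j + 1) := by
  refine ⟨?_, ?_, ?_⟩
  · calc _ ≤ (M * (T + 2)) * (callCount T M j + 1) := by nlinarith
      _ ≤ (M * (T + 2)) * (M * (T + 2)) ^ j := by gcongr; exact callCount_succ_le (by omega) j
      _ ≤ _ := by rw [pow_succ]; nlinarith [Nat.zero_le ((M * (T + 2)) * (M * (T + 2)) ^ j)]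
  · calc _ ≤ (M * (T + 2)) * evalCount T M j := by nlinarith
      _ ≤ (M * (T + 2)) * (M * (T + 2)) ^ j := by gcongr; exact evalCount_le (by omega) j
      _ ≤ _ := by rw [pow_succ]; nlinarith [Nat.zero_le ((M * (T + 2)) * (M * (T + 2)) ^ j)]
  -- The overhead `9` is eight operations for computing `M` and one final division; it is absorbed
  -- because `2 * M + 9 ≤ 4 * M` for `M ≥ 5`.
  · calc _ ≤ (M * (T + 2)) * (opCount T M j + 2) := by nlinarith
      _ ≤ (M * (T + 2)) * (2 * (M * (T + 2)) ^ j) := by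
        gcongr; exact opCount_add_two_le (by omega) j
      _ = _ := by rw [pow_succ]; ring

theorem failBound_add_le {T M : ℕ} (hM : 1 ≤ M) {p : ℝ} (hp : 0 ≤ p) (j : ℕ) :
    failBound T M p j + p ≤ (M * (T + 2)) ^ j * p := by
  have hM' : (1 : ℝ) ≤ M := by exact_mod_cast hM
  induction j with
  | zero => simp [failBound]
  | succ j ih =>
    have h0 := failBound_nonneg T M hp j
    calc failBound T M p (j + 1) + p ≤ (M * (T + 2)) * (failBound T M p j + p) := by
          simp only [failBound]
          have : (0 : ℝ) ≤ M * T := by positivity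
          nlinarith [mul_nonneg (sub_nonneg.2 hM') h0, mul_nonneg (sub_nonneg.2 hM') hp,
            mul_nonneg this hp]
      _ ≤ (M * (T + 2)) * ((M * (T + 2)) ^ j * p) := by gcongr
      _ = _ := by ring

theorem program_fail_le {T M : ℕ} (hM : 1 ≤ M) {p : ℝ} (hp : 0 ≤ p) (j : ℕ) :
    M * (T * failBound T M p j) + p ≤ (M * (T + 2)) ^ (j + 1) * p := by
  have hM' : (1 : ℝ) ≤ M := by exact_mod_cast hM
  have h0 := failBound_nonneg T M hp j
  calc M * (T * failBound T M p j) + p ≤ (M * (T + 2)) * (failBound T M p j + p) := by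
        have : (0 : ℝ) ≤ M * T := by positivity
        nlinarith [mul_nonneg (sub_nonneg.2 hM') h0, mul_nonneg (sub_nonneg.2 hM') hp,
            mul_nonneg this hp]
    _ ≤ (M * (T + 2)) * ((M * (T + 2)) ^ j * p) := by gcongr; exact failBound_add_le hM hp j
    _ = _ := by ring

/-! ### The number of repetitions: large enough for accuracy, small enough for the cost -/

section Parameters

variable {T : ℕ} {ε δ : ℝ}

theorem one_le_ratio (hT : 1 ≤ T) (hε : ε ∈ Set.Ioo (0 : ℝ) 1) (hδ : δ ∈ Set.Ioo (0 : ℝ) 1) :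
    1 ≤ T / δ / ε ∧ 1 / ε ≤ T / δ / ε ∧ 1 / δ ≤ T / δ / ε ∧ (T : ℝ) ≤ T / δ / ε := by
  have hT' : (1 : ℝ) ≤ T := by exact_mod_cast hT
  obtain ⟨hε0, hε1⟩ := hε
  obtain ⟨hδ0, hδ1⟩ := hδ
  have h1 : (T : ℝ) ≤ T / δ := le_div_self (by positivity) hδ0 hδ1.le
  have h2 : T / δ ≤ T / δ / ε := le_div_self (by positivity) hε0 hε1.le
  refine ⟨by linarith, ?_, ?_, by linarith⟩
  · gcongr; linarith
  · refine le_trans ?_ h2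
    gcongr

theorem le_reps (j : ℕ) : (Real.log (T / δ / ε) + 1) * 20 ^ (j + 1) / ε / ε ≤ reps T j ε δ := by
  have := Nat.le_ceil ((Real.log (T / δ / ε) + 1) * (20 ^ (j + 1) : ℕ) / ε / ε)
  simpa [reps] using this

theorem one_le_main (hT : 1 ≤ T) (hε : ε ∈ Set.Ioo (0 : ℝ) 1) (hδ : δ ∈ Set.Ioo (0 : ℝ) 1)
    (j : ℕ) : 20 ≤ (Real.log (T / δ / ε) + 1) * 20 ^ (j + 1) / ε / ε := by
  have hx := (one_le_ratio hT hε hδ).1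
  have hlog := Real.log_nonneg hx
  have h20 : (20 : ℝ) ≤ 20 ^ (j + 1) := le_self_pow₀ (by norm_num) (by omega)
  have h1 : (20 : ℝ) ≤ (Real.log (T / δ / ε) + 1) * 20 ^ (j + 1) := by nlinarith
  have h2 := le_div_self (by linarith : 0 ≤ (Real.log (T / δ / ε) + 1) * 20 ^ (j + 1)) hε.1 hε.2.le
  exact h1.trans (h2.trans (le_div_self (by linarith) hε.1 hε.2.le))

theorem reps_le (hT : 1 ≤ T) (hε : ε ∈ Set.Ioo (0 : ℝ) 1) (hδ : δ ∈ Set.Ioo (0 : ℝ) 1) (j : ℕ) :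
    (reps T j ε δ : ℝ) ≤ 40 ^ (j + 1) * (Real.log (T / δ / ε) + 1) * (1 / ε) ^ 2 := by
  have h1 := one_le_main hT hε hδ j
  have h2 : (reps T j ε δ : ℝ) < (Real.log (T / δ / ε) + 1) * 20 ^ (j + 1) / ε / ε + 1 := by
    have := Nat.ceil_lt_add_one
      (show 0 ≤ (Real.log (T / δ / ε) + 1) * (20 ^ (j + 1) : ℕ) / ε / ε by push_cast; linarith)
    simpa [reps] using this
  have hlog := Real.log_nonneg (one_le_ratio hT hε hδ).1
  have hε0 := hε.1
  calc (reps T j ε δ : ℝ) ≤ 2 * ((Real.log (T / δ / ε) + 1) * 20 ^ (j + 1) / ε / ε) := by linarith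
    _ = 2 * 20 ^ (j + 1) * (Real.log (T / δ / ε) + 1) * (1 / ε) ^ 2 := by field_simp
    _ ≤ 2 ^ (j + 1) * 20 ^ (j + 1) * (Real.log (T / δ / ε) + 1) * (1 / ε) ^ 2 := by
        gcongr
        exact le_self_pow₀ (by norm_num) (by omega)
    _ = _ := by rw [← mul_pow]; norm_num

/-- With `k = j + 1`, the constants collect to `2 * 40 ^ (k ^ 2) ≤ 80 ^ (k ^ 2) ≤ 10 ^ (2 * k ^ 2)`,
which is where the quadratic exponent in the cost bound is used. -/
theorem twice_pow_le_costBound (hT : 1 ≤ T) (hε : ε ∈ Set.Ioo (0 : ℝ) 1)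
    (hδ : δ ∈ Set.Ioo (0 : ℝ) 1) (j : ℕ) :
    2 * (reps T j ε δ * (T + 2) : ℝ) ^ (j + 1) ≤ costBound T (j + 2) ε δ := by
  have hlog := Real.log_nonneg (one_le_ratio hT hε hδ).1
  have hε0 := hε.1
  have hδ0 := hδ.1
  have hT0 : (T : ℝ) ≠ 0 := by positivity
  have hL : 1 + Real.log (1 / δ) + Real.log (1 / ε) + Real.log T = Real.log (T / δ / ε) + 1 := by
    rw [one_div, one_div, Real.log_inv, Real.log_inv, Real.log_div (by positivity) hε0.ne',
      Real.log_div hT0 hδ0.ne']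
    ring
  rw [costBound, hL, show j + 2 - 1 = j + 1 from rfl]
  set Λ := Real.log (T / δ / ε) + 1
  have hΛ : 0 ≤ Λ := by positivity
  have hk : (2 : ℝ) ≤ 2 ^ (j + 1) ^ 2 := le_self_pow₀ (by norm_num) (by positivity)
  calc 2 * (reps T j ε δ * (T + 2) : ℝ) ^ (j + 1)
      ≤ 2 ^ (j + 1) ^ 2 * (40 ^ (j + 1) * Λ * (1 / ε) ^ 2 * (T + 2) : ℝ) ^ (j + 1) := by
        gcongr
        exact reps_le hT hε hδ j
    _ = (2 * 40) ^ (j + 1) ^ 2 * (1 / ε) ^ (2 * (j + 1)) * ((T : ℝ) + 2) ^ (j + 1)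
          * Λ ^ (j + 1) := by
        simp only [mul_pow, ← pow_mul, sq (j + 1)]
        ring
    _ ≤ (10 ^ 2) ^ (j + 1) ^ 2 * (1 / ε) ^ (2 * (j + 1)) * ((T : ℝ) + 2) ^ (j + 1)
          * Λ ^ (j + 1) := by
        gcongr
        norm_num
    _ = _ := by rw [← pow_mul]

theorem quadratic_le_five_pow (k : ℕ) : (2 + 4 * k + 4 * k ^ 2 : ℝ) ≤ 8 * 5 ^ k := by
  induction k with
  | zero => norm_num
  | succ k ih =>
    push_cast
    rw [pow_succ (5 : ℝ)]
    nlinarith [sq_nonneg (k : ℝ), Nat.cast_nonneg (α := ℝ) k]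

/-- With `x = T / δ / ε` and `l = log x`, both sides are compared as exponentials of multiples of `l
+ 1`: the union bound costs a factor quadratic in `k`, while the Hoeffding exponent provides `8 * 5
^ k`. -/
theorem fail_le (hT : 1 ≤ T) (hε : ε ∈ Set.Ioo (0 : ℝ) 1) (hδ : δ ∈ Set.Ioo (0 : ℝ) 1) (j : ℕ) :
    (reps T j ε δ * (T + 2) : ℝ) ^ (j + 1) *
      (2 * Real.exp (-2 * reps T j ε δ * (ε / 2 ^ j) ^ 2)) ≤ δ := by
  obtain ⟨hx, hxε, hxδ, hxT⟩ := one_le_ratio hT hε hδ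
  have hlog := Real.log_nonneg hx
  have hε0 := hε.1
  have hδ0 := hδ.1
  have hT' : (1 : ℝ) ≤ T := by exact_mod_cast hT
  have hexp : Real.exp (Real.log (T / δ / ε)) = T / δ / ε := Real.exp_log (by linarith)
  set x := T / δ / ε
  set l := Real.log x
  set M := reps T j ε δ with hMdef
  set k := j + 1 with hk
  have hΛ : l + 1 ≤ x := by rw [← hexp]; exact Real.add_one_le_exp l
  have he : (2.7 : ℝ) ≤ Real.exp 1 := by linarith [Real.exp_one_gt_d9]
  have h40 : (40 : ℝ) ≤ Real.exp 4 := by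
    calc (40 : ℝ) ≤ 2.7 ^ 4 := by norm_num
      _ ≤ Real.exp 1 ^ 4 := by gcongr
      _ = Real.exp 4 := by rw [← Real.exp_nat_mul]; norm_num
  have h3 : (3 : ℝ) ≤ Real.exp 4 := by linarith
  -- One power of `x` each bounds `l + 1` and `T`, two bound `ε⁻²`; the constants `40` and `3` are
  -- at most `exp 4`.
  have hA : (M * (T + 2) : ℝ) ≤ Real.exp (4 * k + 4 * (l + 1)) := by
    calc (M * (T + 2) : ℝ) ≤ (40 ^ k * (l + 1) * (1 / ε) ^ 2) * (3 * T) := by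
          gcongr
          · exact reps_le hT hε hδ j
          · linarith
      _ ≤ (Real.exp 4 ^ k * x * x ^ 2) * (Real.exp 4 * x) := by gcongr
      _ = Real.exp (4 * k + 4 * (l + 1)) := by
          rw [← hexp, ← Real.exp_nat_mul, ← Real.exp_nat_mul, ← Real.exp_add, ← Real.exp_add,
            ← Real.exp_add, ← Real.exp_add]
          congr 1
          push_cast
          ring
  have h2 : (2 : ℝ) ≤ Real.exp (l + 1) := by
    have := Real.add_one_le_exp (l + 1)
    linarith
  have hδ' : 1 / δ ≤ Real.exp (l + 1) := by
    refine hxδ.trans ?_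
    rw [← hexp]
    exact Real.exp_le_exp.2 (by linarith)
  -- The base `20 = 5 * 4` in `reps`: the `4` pays for `η² = ε² / 4 ^ j`, the `5` is left to beat
  -- the quadratic.
  have hM : 8 * 5 ^ k * (l + 1) ≤ 2 * M * (ε / 2 ^ j) ^ 2 := by
    have h := le_reps (T := T) (ε := ε) (δ := δ) j
    rw [← hMdef, ← hk] at h
    calc 8 * 5 ^ k * (l + 1) = 2 * ((l + 1) * 20 ^ k / ε / ε) * (ε / 2 ^ j) ^ 2 := by
          have h20 : (20 : ℝ) ^ k = 5 ^ k * (4 * (2 ^ j) ^ 2) := by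
            rw [show (20 : ℝ) = 5 * 2 ^ 2 by norm_num, mul_pow, ← pow_mul, ← pow_mul, hk]
            ring
          rw [h20]
          field_simp
          ring
      _ ≤ _ := by gcongr
  have hkey : 2 * (M * (T + 2) : ℝ) ^ k * (1 / δ) ≤ Real.exp (2 * M * (ε / 2 ^ j) ^ 2) := by
    calc 2 * (M * (T + 2) : ℝ) ^ k * (1 / δ)
        ≤ Real.exp (l + 1) * Real.exp (4 * k + 4 * (l + 1)) ^ k * Real.exp (l + 1) := by gcongr
      _ = Real.exp ((l + 1) + k * (4 * k + 4 * (l + 1)) + (l + 1)) := by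
          rw [← Real.exp_nat_mul, ← Real.exp_add, ← Real.exp_add]
      _ ≤ Real.exp (8 * 5 ^ k * (l + 1)) := by
          refine Real.exp_le_exp.2 ?_
          have h5 := mul_le_mul_of_nonneg_right (quadratic_le_five_pow k) (by linarith : 0 ≤ l + 1)
          have h6 : (0 : ℝ) ≤ 4 * k ^ 2 * l := by positivity
          nlinarith
      _ ≤ _ := Real.exp_le_exp.2 hM
  rw [show -2 * (M : ℝ) * (ε / 2 ^ j) ^ 2 = -(2 * M * (ε / 2 ^ j) ^ 2) by ring, Real.exp_neg]
  rw [mul_one_div, div_le_iff₀ hδ0] at hkey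
  rw [← mul_assoc, ← div_eq_mul_inv, div_le_iff₀ (Real.exp_pos _)]
  linarith

end Parameters

end NestedSim

/-! ### The main theorem -/

open NestedSim

theorem theorem6 (k : ℕ) (hk : 1 ≤ k) :
    ∃ prog : NestedSim.Code,
      ∀ (T D : ℕ) (_hT : 1 ≤ T)
        (Ω : Type*) [MeasurableSpace Ω] (P : Measure Ω) [IsProbabilityMeasure P]
        (Y : Ω → NestedSim.Hist D T) (_hY : Measurable Y)
        (g : (t : ℕ) → NestedSim.Hist D t → ℝ) (_hg : ∀ t, 1 ≤ t → t ≤ T → Measurable (g t))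
        (_hZ : ∀ᵐ ω ∂P, ∀ i : Fin T, NestedSim.payoffProc Y g i ω ∈ Set.Icc (0 : ℝ) 1)
        (S : Type*) [MeasurableSpace S] (ν : Measure S) [IsProbabilityMeasure ν]
        (sim : (t : ℕ) → NestedSim.Hist D t → S → NestedSim.Hist D T)
        (_hsim : NestedSim.IsSimulator P Y ν sim)
        (C G : ℝ) (_hC : 1 ≤ C) (_hG : 1 ≤ G)
        (ε δ : ℝ) (_hε : ε ∈ Set.Ioo (0 : ℝ) 1) (_hδ : δ ∈ Set.Ioo (0 : ℝ) 1),
        (∀ seed : ℕ → S,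
          (NestedSim.run g sim prog ε δ seed).time C G
              ≤ (C + G + 1) * NestedSim.costBound T (k + 1) ε δ ∧
          ((NestedSim.run g sim prog ε δ seed).calls : ℝ)
              ≤ NestedSim.costBound T (k + 1) ε δ) ∧
        Measurable (fun seed : ℕ → S => (NestedSim.run g sim prog ε δ seed).output) ∧
        1 - δ ≤ (Measure.infinitePi fun _ : ℕ => ν).real
          {seed | |(NestedSim.run g sim prog ε δ seed).output
                    - NestedSim.levelValue P Y g k| ≤ ε} := by
  obtain ⟨j, rfl⟩ : ∃ j, k = j + 1 := ⟨k - 1, by omega⟩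
  refine ⟨program j, ?_⟩
  intro T D hT Ω _ P _ Y hY g hg hZ S _ ν _ sim hsim C G hC hG ε δ hε hδ
  obtain ⟨M, hM⟩ : ∃ M, reps T j ε δ = M := ⟨reps T j ε δ, rfl⟩
  have hM20 : 20 ≤ M := by
    have := (one_le_main hT hε hδ j).trans (le_reps j)
    rw [hM] at this
    exact_mod_cast this
  have hrun := fun seed => run_program g sim j ε δ seed hM
  have hcost := twice_pow_le_costBound hT hε hδ j
  rw [hM] at hcost
  obtain ⟨h1, h2, h3⟩ := program_cost_le (T := T) (M := M) (by omega) j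
  have hcast : ∀ n : ℕ, n ≤ 2 * (M * (T + 2)) ^ (j + 1) →
      (n : ℝ) ≤ costBound T (j + 1 + 1) ε δ := fun n hn =>
    le_trans (by exact_mod_cast hn) hcost
  have hout : (fun seed : ℕ → S => (run g sim (program j) ε δ seed).output) =
      fun seed => avgMin sim M (callCount T M j) (est g sim M j) 0 0 seed :=
    funext fun seed => (hrun seed).1
  have hmeas : Measurable fun seed : ℕ → S =>
      avgMin sim M (callCount T M j) (est g sim M j) 0 0 seed :=
    measurable_avgMin_right (hsim.measurable_simAt (Nat.zero_le T))
      (measurable_est hg (fun t ht => hsim.measurable_simAt ht) M j) M (callCount T M j) 0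
  refine ⟨fun seed => ?_, by rw [hout]; exact hmeas, ?_⟩
  · obtain ⟨-, hc, he, ho⟩ := hrun seed
    have hc' := hcast _ h1
    have he' := hcast _ h2
    have ho' := hcast _ h3
    rw [← hc] at hc'
    rw [← he] at he'
    rw [← ho] at ho'
    refine ⟨?_, hc'⟩
    have hC' := mul_le_mul_of_nonneg_left hc' (zero_le_one.trans hC)
    have hG' := mul_le_mul_of_nonneg_left he' (zero_le_one.trans hG)
    rw [Memory.time, add_mul, add_mul, one_mul]
    exact add_le_add (add_le_add hC' hG') ho'
  · have hε0 := hε.1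
    -- The choice `η = ε / 2 ^ j` turns the accumulated error `2 ^ j η` into `ε`.
    have hacc := avgMin_est_accuracy hY hg hT hZ hsim (M := M) (by omega)
      (η := ε / 2 ^ j) (by positivity) j 0
    rw [mul_div_cancel₀ ε (by positivity : (2 : ℝ) ^ j ≠ 0)] at hacc
    have hδ' := fail_le hT hε hδ j
    rw [hM] at hδ'
    have hp : 0 ≤ 2 * Real.exp (-2 * M * (ε / 2 ^ j) ^ 2) := by positivity
    have hfail := hacc.trans ((program_fail_le (by omega) hp j).trans hδ')
    simp only [fun seed => (hrun seed).1]
    have hset : MeasurableSet {seed : ℕ → S |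
        ε < |avgMin sim M (callCount T M j) (est g sim M j) 0 0 seed
          - levelValue P Y g (j + 1)|} :=
      measurableSet_lt measurable_const (hmeas.sub measurable_const).abs
    have hcompl := probReal_compl_eq_one_sub (μ := Measure.infinitePi fun _ : ℕ => ν) hset
    have : {seed : ℕ → S | |avgMin sim M (callCount T M j) (est g sim M j) 0 0 seed
          - levelValue P Y g (j + 1)| ≤ ε} = {seed : ℕ → S |
        ε < |avgMin sim M (callCount T M j) (est g sim M j) 0 0 seed
          - levelValue P Y g (j + 1)|}ᶜ := by
      ext; simp
    rw [this, hcompl]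
    exact sub_le_sub_left hfail 1
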